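/- Let $M$ be a finite simplicial complex (a finite family of finite vertex sets, closed under taking subsets, so that $\varnothing$ counts as a simplex) with linearly ordered vertices, let $p\ge 1$, and let $\Omega_*^{\otimes p}$ be the real or complex vector space with basis the $p$-tuples $e=(\sigma_1,\dots,\sigma_p)=\sigma_1\otimes\dots\otimes\sigma_p$ of simplexes of $M$. On $\Omega_*$ (the case $p=1$) put $$d(s)=\sum_{x\notin s,\ s\cup\{x\}\in M}\beta_{x\to s\cup x}\,(s\cup\{x\}),\qquad \partial(s)=\sum_{x\in s}\beta_{x\to s}\,(s\setminus\{x\}),$$ where $\beta_{x\to s}=(-1)^{\#\{y\in s:\,y\le x\}}$, and lift $O=d,\partial$ to $\Omega_*^{\otimes p}$ by $$O(\sigma_1\otimes\dots\otimes\sigma_p)=(-1)^{p-1}\sum_{j}(-1)^{|\sigma_1|+\dots+|\sigma_{j-1}|}\,\sigma_1\otimes\dots\otimes O(\sigma_j)\otimes\dots\otimes\sigma_p,$$ where $|s|=\dim s=\#s-1$. The envelope of $e$ is the smallest simplex of $M$ containing $\sigma_1,\dots,\sigma_p$, and $\varnothing$ if there is none. A vertex of the envelope is free if it lies in exactly one of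 the $\sigma_j$. The localization $[O]$ of an operator $O$ keeps, in the image of each tuple $e$, only the tuples with the same envelope as $e$. The local Laplacian is $\Delta_{loc}=[d][\partial]+[\partial][d]$. Let $\sigma\in M$ be a nonempty simplex with $n$ vertices and let $\tau\subseteq\sigma$ have $k$ elements. Let $\Omega_*^{\otimes p}(\sigma,\tau)$ be the span of the $p$-tuples with envelope $\sigma$ and set of free vertices $\tau$. A placement of the non-free vertices is a $p$-tuple $c=(c_1,\dots,c_p)$ of subsets of $\sigma\setminus\tau$ such that each vertex of $\sigma\setminus\tau$ lies in at least two of the $c_j$. Let $\Omega_*^{\otimes p}(\sigma,\tau;c)$ be the span of those tuples of $\Omega_*^{\otimes p}(\sigma,\tau)$ for which $\sigma_j\setminus\tau=c_j$ for all $j$. Put $$\lambda_i=(n-i)\,p,\qquad i=0,\dots,k .$$ 1. $\Omega_*^{\otimes p}(\sigma,\tau)$ is invariant under $\Delta_{loc}$, which is self-adjoint on it with respect to the inner product that makes the tuples orthonormal. It has dimension $p^k(2^p-p-1)^{n-k}$, and on it $\Delta_{loc}$ is diagonalizable with eigenvalues $\lambda_i$ of multiplicities $\binom{k}{i}(p-1)^{k-i}(2^p-p-1)^{n-k}$,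 $i=0,\dots,k$ (multiplicity $0$ meaning that $\lambda_i$ does not occur). 2. For every placement $c$, the space $\Omega_*^{\otimes p}(\sigma,\tau;c)$ is $p^k$-dimensional and invariant under $\Delta_{loc}$, and on it $\Delta_{loc}$ is diagonalizable with eigenvalues $\lambda_i$ of multiplicities $\binom{k}{i}(p-1)^{k-i}$, $i=0,\dots,k$. 3. Define a bilinear product on $\Omega_*^{\otimes p}$ by $$(\sigma_1\otimes\dots\otimes\sigma_p)\star(\sigma_1'\otimes\dots\otimes\sigma_p')=(-1)^{\chi}\,(\sigma_1\cup\sigma_1')\otimes\dots\otimes(\sigma_p\cup\sigma_p')$$ ($0$ if some $\sigma_j\cup\sigma_j'$ is not a simplex), where $\chi$ is the number of $(i,x,j,y)$ with $x\in\sigma_i$, $y\in\sigma'_j$ and either $j<i$, or $j=i$ and $y<x$. If $e,f$ are tuples of simplexes without common vertices and the union of all their simplexes is a simplex of $M$, then $\Delta_{loc}(e\star f)=(\Delta_{loc}e)\star f+e\star(\Delta_{loc}f)$. For a vertex $x$ let $x_j$ ($0\le j\le p-1$) be the tuple with $\{x\}$ at place $j$ (places counted from $0$) and $\varnothing$ elsewhere,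 and put $$|0\rangle_x=\sum_{j=0}^{p-1}(-1)^j x_j,\qquad |m\rangle_x=(-1)^{m-1}x_{m-1}-(-1)^m x_m\quad(1\le m\le p-1).$$ Then for every placement $c$ and every enumeration $t_1,\dots,t_k$ of $\tau$, the vectors $$|n_1,\dots,n_k\rangle=c\star|n_1\rangle_{t_1}\star\dots\star|n_k\rangle_{t_k},\qquad 0\le n_i\le p-1,$$ (products bracketed from the left) form a basis of $\Omega_*^{\otimes p}(\sigma,\tau;c)$, and $$\Delta_{loc}|n_1,\dots,n_k\rangle=p\,\bigl(n-k+\#\{i:\,n_i>0\}\bigr)\,|n_1,\dots,n_k\rangle .$$ -/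

import Mathlib

/-- A (finite, abstract) simplicial complex with vertices in `V`: a finite collection of finite
sets, the simplexes, such that every subset of a simplex is a simplex. The empty set is a simplex
of every nonempty complex. -/
structure DiscreteComplex (V : Type*) where
  faces : Finset (Finset V)
  down_closed : ∀ s ∈ faces, ∀ t ⊆ s, t ∈ faces

namespace DiscreteComplex

section

variable {V : Type*} [LinearOrder V] (M : DiscreteComplex V) (𝕜 : Type*) [RCLike 𝕜]

/-- The simplexes of `M`. -/
abbrev Simplex : Type _ := {s : Finset V // s ∈ M.faces}

/-- The set of vertices of `M`. -/
def vertices : Finset V := M.faces.biUnion id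

/-- The space `Ω_*` of discrete forms, with the simplexes as its basis. -/
abbrev Forms : Type _ := M.Simplex →₀ 𝕜

/-- The space `Ω_*^{⊗p}`, with the `p`-tuples of simplexes as its basis: the basis vector
`Finsupp.single e 1` stands for `e 0 ⊗ e 1 ⊗ ⋯ ⊗ e (p - 1)`. -/
abbrev TensorForms (p : ℕ) : Type _ := (Fin p → M.Simplex) →₀ 𝕜

variable {M} {𝕜}

/-! ### The differential and the co-differential on forms -/

/-- The sign `β_{x → s} = (-1) ^ ord (x → s)`, where `ord (x → s)` is the number of vertices of
`s` that are at most `x`. -/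
def beta (𝕜 : Type*) [RCLike 𝕜] (x : V) (s : Finset V) : 𝕜 :=
  (-1) ^ (s.filter (· ≤ x)).card

/-- The basis form of `s` if `s` is a simplex of `M`, and `0` otherwise. -/
noncomputable def formVec (M : DiscreteComplex V) (𝕜 : Type*) [RCLike 𝕜] (s : Finset V) :
    M.Forms 𝕜 :=
  if h : s ∈ M.faces then Finsupp.single ⟨s, h⟩ 1 else 0

/-- The discrete de Rham differential `d s = ∑_{x ∉ s} β_{x → s ∪ x} (s ∪ x)`, the sum being over
the vertices `x ∉ s` of `M` for which `s ∪ x` is a simplex. -/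
noncomputable def d (M : DiscreteComplex V) (𝕜 : Type*) [RCLike 𝕜] :
    M.Forms 𝕜 →ₗ[𝕜] M.Forms 𝕜 :=
  Finsupp.linearCombination 𝕜 fun s : M.Simplex =>
    ∑ x ∈ M.vertices \ s.1, beta 𝕜 x (insert x s.1) • formVec M 𝕜 (insert x s.1)

/-- The co-differential `∂ s = ∑_{x ∈ s} β_{x → s} (s \ x)`. -/
noncomputable def del (M : DiscreteComplex V) (𝕜 : Type*) [RCLike 𝕜] :
    M.Forms 𝕜 →ₗ[𝕜] M.Forms 𝕜 :=
  Finsupp.linearCombination 𝕜 fun s : M.Simplex =>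
    ∑ x ∈ s.1, beta 𝕜 x s.1 • formVec M 𝕜 (s.1.erase x)

/-- The lifting of an operation `O : Ω_* → Ω_*` (of degree `±1`) to `Ω_*^{⊗p}`:
`O (s₁ ⊗ ⋯ ⊗ s_p) =
  (-1)^(p-1) ∑_j (-1)^(|s₁| + ⋯ + |s_{j-1}|) s₁ ⊗ ⋯ ⊗ O(s_j) ⊗ ⋯ ⊗ s_p`,
where `|s|` is the dimension of the simplex `s`, i.e. its number of vertices minus one
(so that `|∅| = -1`). -/
noncomputable def lift (p : ℕ) (O : M.Forms 𝕜 →ₗ[𝕜] M.Forms 𝕜) :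
    M.TensorForms 𝕜 p →ₗ[𝕜] M.TensorForms 𝕜 p :=
  Finsupp.linearCombination 𝕜 fun e : Fin p → M.Simplex =>
    ∑ j : Fin p,
      ((-1 : 𝕜) ^ (((p : ℤ) - 1) + ∑ i ∈ Finset.univ.filter (· < j), (((e i).1.card : ℤ) - 1))) •
        Finsupp.mapDomain (fun s : M.Simplex => Function.update e j s)
          (O (Finsupp.single (e j) 1))

/-! ### Local envelopes and localization -/

/-- The union of the simplexes of a tuple. -/
def support {p : ℕ} (e : Fin p → M.Simplex) : Finset V :=
  Finset.univ.biUnion fun i => (e i).1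

/-- The local envelope of a tuple of simplexes: the minimal simplex of `M` that contains all of
them, and `∅` if there is no such simplex. -/
def envelope {p : ℕ} (e : Fin p → M.Simplex) : Finset V :=
  if support e ∈ M.faces then support e else ∅

/-- If some simplex contains all simplexes of `e`, then the envelope is the least such simplex. -/
theorem isLeast_envelope {p : ℕ} (e : Fin p → M.Simplex)
    (h : ∃ s ∈ M.faces, ∀ i, (e i).1 ⊆ s) :
    IsLeast {s : Finset V | s ∈ M.faces ∧ ∀ i, (e i).1 ⊆ s} (envelope e) := by
  obtain ⟨s, hs, hes⟩ := h
  have hsub : ∀ t : Finset V, (∀ i, (e i).1 ⊆ t) → support e ⊆ t := fun t ht =>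
    Finset.biUnion_subset.2 fun i _ => ht i
  have hmem : support e ∈ M.faces := M.down_closed s hs _ (hsub s hes)
  have henv : envelope e = support e := if_pos hmem
  rw [henv]
  exact ⟨⟨hmem, fun i => Finset.subset_biUnion_of_mem (fun i => (e i).1) (Finset.mem_univ i)⟩,
    fun t ht => hsub t ht.2⟩

/-- If no simplex contains all simplexes of `e`, then the envelope is empty. -/
theorem envelope_eq_empty {p : ℕ} (e : Fin p → M.Simplex)
    (h : ¬ ∃ s ∈ M.faces, ∀ i, (e i).1 ⊆ s) : envelope e = ∅ :=
  if_neg fun hmem => h ⟨_, hmem, fun i =>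
    Finset.subset_biUnion_of_mem (fun i => (e i).1) (Finset.mem_univ i)⟩

/-- The free vertices of a tuple: the vertices of its envelope that belong to one and only one
simplex of the tuple. -/
def freeVertices {p : ℕ} (e : Fin p → M.Simplex) : Finset V :=
  (envelope e).filter fun x => (Finset.univ.filter fun i => x ∈ (e i).1).card = 1

/-- The strictly local part `[O]` of an operation `O`: in the image of each tuple `e`, only the
tuples with the same envelope as `e` are kept. -/
noncomputable def localize {p : ℕ} (O : M.TensorForms 𝕜 p →ₗ[𝕜] M.TensorForms 𝕜 p) :
    M.TensorForms 𝕜 p →ₗ[𝕜] M.TensorForms 𝕜 p :=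
  Finsupp.linearCombination 𝕜 fun e : Fin p → M.Simplex =>
    (O (Finsupp.single e 1)).filter fun e' => envelope e' = envelope e

/-- The local Laplace operator `[d][∂] + [∂][d]` on `Ω_*^{⊗p}`. -/
noncomputable def localLaplacian (M : DiscreteComplex V) (𝕜 : Type*) [RCLike 𝕜] (p : ℕ) :
    M.TensorForms 𝕜 p →ₗ[𝕜] M.TensorForms 𝕜 p :=
  localize (lift p (d M 𝕜)) ∘ₗ localize (lift p (del M 𝕜)) +
    localize (lift p (del M 𝕜)) ∘ₗ localize (lift p (d M 𝕜))

/-! ### The subspaces with given envelope and given free vertices -/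

/-- The subspace `Ω_*^{⊗p}(σ, τ)` spanned by the `p`-tuples with envelope `σ` and with `τ` as
set of free vertices. -/
noncomputable def freeSubspace (M : DiscreteComplex V) (𝕜 : Type*) [RCLike 𝕜] (p : ℕ) (σ τ : Finset V) :
    Submodule 𝕜 (M.TensorForms 𝕜 p) :=
  Submodule.span 𝕜 {v | ∃ e : Fin p → M.Simplex,
    envelope e = σ ∧ freeVertices e = τ ∧ v = Finsupp.single e 1}

/-- `c` is a placement of the vertices of `ρ` as non-free vertices: a tuple of simplexes with
vertices in `ρ`, such that every vertex of `ρ` lies in at least two simplexes of the tuple. -/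
def IsPlacement {p : ℕ} (c : Fin p → M.Simplex) (ρ : Finset V) : Prop :=
  (∀ i, (c i).1 ⊆ ρ) ∧ ∀ x ∈ ρ, 2 ≤ (Finset.univ.filter fun i => x ∈ (c i).1).card

/-- The subspace `Ω_*^{⊗p}(σ, τ; c)` of `Ω_*^{⊗p}(σ, τ)` spanned by the `p`-tuples with envelope
`σ` and with `τ` as set of free vertices, whose non-free vertices are placed as in `c`. -/
noncomputable def placedSubspace (𝕜 : Type*) [RCLike 𝕜] {p : ℕ} (σ τ : Finset V) (c : Fin p → M.Simplex) :
    Submodule 𝕜 (M.TensorForms 𝕜 p) :=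
  Submodule.span 𝕜 {v | ∃ e : Fin p → M.Simplex,
    envelope e = σ ∧ freeVertices e = τ ∧ (∀ i, (e i).1 \ τ = (c i).1) ∧
      v = Finsupp.single e 1}

/-- `W` is invariant under `T`, and `T` is diagonalizable on `W` with the eigenvalues `lam i`,
of multiplicities `N i`: `W` is the direct sum of the eigenspaces of `T` on `W` for the
numbers `lam i`, and these have dimensions `N i`. -/
def IsDiagonalizableOn {E ι : Type*} [DecidableEq ι] [AddCommGroup E] [Module 𝕜 E]
    (T : E →ₗ[𝕜] E) (W : Submodule 𝕜 E) (lam : ι → 𝕜) (N : ι → ℕ) : Prop :=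
  ∃ h : ∀ v ∈ W, T v ∈ W,
    DirectSum.IsInternal (fun i => Module.End.eigenspace (T.restrict h) (lam i)) ∧
      ∀ i, Module.finrank 𝕜 (Module.End.eigenspace (T.restrict h) (lam i)) = N i

/-! ### The `⋆`-product and the eigenvectors -/

/-- The basis vector of a tuple of vertex sets if all of them are simplexes of `M`, and `0`
otherwise. -/
noncomputable def tupleVec (M : DiscreteComplex V) (𝕜 : Type*) [RCLike 𝕜] {p : ℕ}
    (e : Fin p → Finset V) : M.TensorForms 𝕜 p :=
  if h : ∀ i, e i ∈ M.faces then Finsupp.single (fun i => ⟨e i, h i⟩) 1 else 0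

/-- The exponent `χ` of the sign in the `⋆`-product `e ⋆ f`: the number of quadruples
`(i, x, j, y)` with `x ∈ e i`, `y ∈ f j` and `(j, y) < (i, x)` lexicographically. -/
def starSign {p : ℕ} (e f : Fin p → M.Simplex) : ℕ :=
  ∑ i : Fin p, ∑ j : Fin p,
    (((e i).1 ×ˢ (f j).1).filter fun z => j < i ∨ (j = i ∧ z.2 < z.1)).card

/-- The bilinear `⋆`-product
`(s₁ ⊗ ⋯ ⊗ s_p) ⋆ (s'₁ ⊗ ⋯ ⊗ s'_p) = (-1)^χ (s₁ ∪ s'₁) ⊗ ⋯ ⊗ (s_p ∪ s'_p)`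
(zero if one of the unions is not a simplex of `M`). -/
noncomputable def star {p : ℕ} (u v : M.TensorForms 𝕜 p) : M.TensorForms 𝕜 p :=
  u.sum fun e a => v.sum fun f b =>
    (a * b * (-1) ^ starSign e f) • tupleVec M 𝕜 fun i => (e i).1 ∪ (f i).1

/-- The tuple `∅ ⊗ ⋯ ⊗ {x} ⊗ ⋯ ⊗ ∅`, with `{x}` at place `j` (counted from `0`). -/
noncomputable def point (M : DiscreteComplex V) (𝕜 : Type*) [RCLike 𝕜] (p : ℕ) (x : V) (j : ℕ) :
    M.TensorForms 𝕜 p :=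
  tupleVec M 𝕜 fun i => if (i : ℕ) = j then {x} else ∅

/-- The one-point eigenvectors at the vertex `x`, for `0 ≤ m ≤ p - 1`. In the basis
`point x 0, …, point x (p - 1)`, and with `E = diag (1, -1, 1, …)`, they are
`|0⟩ = E (1, 1, …, 1)`, `|1⟩ = E (1, -1, 0, …)`, `|2⟩ = E (0, 1, -1, 0, …)`, …. -/
noncomputable def ket (M : DiscreteComplex V) (𝕜 : Type*) [RCLike 𝕜] (p : ℕ) (x : V) (m : ℕ) :
    M.TensorForms 𝕜 p :=
  if m = 0 then ∑ j ∈ Finset.range p, (-1 : 𝕜) ^ j • point M 𝕜 p x j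
  else (-1 : 𝕜) ^ (m - 1) • point M 𝕜 p x (m - 1) - (-1 : 𝕜) ^ m • point M 𝕜 p x m

/-- The vector `|n₁, …, n_k⟩ = c ⋆ |n₁⟩ ⋆ ⋯ ⋆ |n_k⟩`, with `|n_i⟩` taken at the vertex `t i`
(products are bracketed from the left). -/
noncomputable def eigenvector (𝕜 : Type*) [RCLike 𝕜] {p k : ℕ} (c : Fin p → M.Simplex)
    (t : Fin k → V) (n : Fin k → Fin p) : M.TensorForms 𝕜 p :=
  Fin.foldl k (fun v i => star v (ket M 𝕜 p (t i) (n i))) (Finsupp.single c 1)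

end

end DiscreteComplex

/-!
A `p`-tuple of vertex sets is the same as a finite set of *sites*, i.e. of pairs (place, vertex),
and the sites are linearly ordered lexicographically. In this encoding `Ω_*^{⊗p}` becomes a
fermionic Fock space: up to the factor `η_a = (-1) ^ (p + place of a)`, the signs in the lifted
operators are the Jordan–Wigner signs `(-1) ^ #{b ∈ S | b < a}`, so that the lifts of `d` and `∂`
are `∑ η_a a†` and `∑ η_a a`, and `⋆` is the product of the exterior algebra.

On sets of sites with vertex set `σ`, localization restricts `d` to sites over `σ` and forbids `∂`
to remove the last site over a vertex. In `[d][∂] + [∂][d]` all mixed terms cancel by the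
anticommutation relation `sgn_anticomm`, except those that move the only site over a vertex to
another place. The result is the explicit formula `localLaplacian_vec`: `Δ_loc` is `p · #σ` minus
the sum over all free vertices of the operators which put this vertex at each place in turn, with
signs. These operators act on one vertex at a time and conserve the parity, which gives the
Leibniz rule `localLaplacian_starHom_vec`.

By the Leibniz rule the spectral problem reduces to two cases: a placement `c`, which has no free
vertices and so is an eigenvector for `p · #(σ \ τ)`, and the `p`-dimensional space of a single
vertex, where `Δ_loc` is `p` times the projection orthogonal to `|0⟩` (`localLaplacian_ket`). The
products of these eigenvectors span the same space as the tuples with non-free vertices placed as in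
`c` (`span_eigenvector`), so by counting they are a basis. Letting `c` run over all placements gives
an eigenbasis of `Ω_*^{⊗p}(σ, τ)`; the multiplicities are the numbers of `m : Fin k → Fin p` with a
given number of zeros, times the number of placements (`card_placements`).

Self-adjointness holds on the whole space, since `d` and `∂` have transposed real matrices and both
lifting and localization respect transposition.
-/

namespace DiscreteComplex

/-! ### Sets of sites and their signs -/

section Sites

variable {V : Type*} [LinearOrder V] {p : ℕ}

/-- The set of sites `(j, x)` with `x ∈ g j`. Sites are ordered lexicographically, by their place
`j` first. -/
def siteSet (g : Fin p → Finset V) : Finset (Fin p ×ₗ V) :=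
  Finset.univ.biUnion fun j => (g j).image fun x => toLex (j, x)

/-- The set of vertices that a set of sites has at the place `j`; `slice` is inverse to
`siteSet`. -/
def slice (S : Finset (Fin p ×ₗ V)) (j : Fin p) : Finset V :=
  (S.filter fun a => (ofLex a).1 = j).image fun a => (ofLex a).2

/-- The set of vertices occurring in a set of sites. -/
def vert (S : Finset (Fin p ×ₗ V)) : Finset V := S.image fun a => (ofLex a).2

theorem mem_siteSet {g : Fin p → Finset V} {a : Fin p ×ₗ V} :
    a ∈ siteSet g ↔ (ofLex a).2 ∈ g (ofLex a).1 := by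
  simp only [siteSet, Finset.mem_biUnion, Finset.mem_univ, true_and, Finset.mem_image]
  constructor
  · rintro ⟨j, x, hx, rfl⟩
    exact hx
  · intro h
    exact ⟨_, _, h, rfl⟩

theorem mem_slice {S : Finset (Fin p ×ₗ V)} {j : Fin p} {x : V} :
    x ∈ slice S j ↔ toLex (j, x) ∈ S := by
  simp only [slice, Finset.mem_image, Finset.mem_filter]
  constructor
  · rintro ⟨a, ⟨ha, rfl⟩, rfl⟩
    exact ha
  · intro h
    exact ⟨_, ⟨h, rfl⟩, rfl⟩

theorem mem_vert {S : Finset (Fin p ×ₗ V)} {x : V} :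
    x ∈ vert S ↔ ∃ a ∈ S, (ofLex a).2 = x := by
  simp [vert]

theorem slice_siteSet (g : Fin p → Finset V) : slice (siteSet g) = g := by
  ext j x
  simp [mem_slice, mem_siteSet]

theorem siteSet_slice (S : Finset (Fin p ×ₗ V)) : siteSet (slice S) = S := by
  ext a
  rw [mem_siteSet, mem_slice]
  rfl

theorem slice_subset_vert (S : Finset (Fin p ×ₗ V)) (j : Fin p) : slice S j ⊆ vert S :=
  fun _ hx => mem_vert.2 ⟨_, mem_slice.1 hx, rfl⟩

theorem sum_siteSet {A : Type*} [AddCommMonoid A] (g : Fin p → Finset V)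
    (f : Fin p ×ₗ V → A) :
    ∑ a ∈ siteSet g, f a = ∑ j, ∑ x ∈ g j, f (toLex (j, x)) := by
  rw [siteSet, Finset.sum_biUnion]
  · refine Finset.sum_congr rfl fun j _ => ?_
    rw [Finset.sum_image]
    intro x _ y _ h
    exact congrArg (fun a : Fin p ×ₗ V => (ofLex a).2) h
  · intro i _ j _ hij
    rw [Function.onFun, Finset.disjoint_left]
    intro a hi hj
    simp only [Finset.mem_image] at hi hj
    obtain ⟨x, _, rfl⟩ := hi
    obtain ⟨y, _, h⟩ := hj
    exact hij (congrArg (fun a : Fin p ×ₗ V => (ofLex a).1) h).symm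

theorem card_siteSet (g : Fin p → Finset V) : (siteSet g).card = ∑ j, (g j).card := by
  rw [Finset.card_eq_sum_ones, sum_siteSet]
  simp

theorem slice_insert (S : Finset (Fin p ×ₗ V)) (j : Fin p) (x : V) :
    slice (insert (toLex (j, x)) S) = Function.update (slice S) j (insert x (slice S j)) := by
  ext i y
  rcases eq_or_ne i j with rfl | h
  · simp [mem_slice]
  · simp [mem_slice, h]

theorem slice_erase (S : Finset (Fin p ×ₗ V)) (j : Fin p) (x : V) :
    slice (S.erase (toLex (j, x))) = Function.update (slice S) j ((slice S j).erase x) := by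
  ext i y
  rcases eq_or_ne i j with rfl | h
  · simp [mem_slice]
  · simp [mem_slice, h]

theorem vert_insert (S : Finset (Fin p ×ₗ V)) (a : Fin p ×ₗ V) :
    vert (insert a S) = insert (ofLex a).2 (vert S) := by
  simp [vert]

theorem vert_erase_subset (S : Finset (Fin p ×ₗ V)) (a : Fin p ×ₗ V) :
    vert (S.erase a) ⊆ vert S :=
  Finset.image_subset_image (Finset.erase_subset _ _)

theorem vert_union (S T : Finset (Fin p ×ₗ V)) : vert (S ∪ T) = vert S ∪ vert T := by
  simp [vert, Finset.image_union]

theorem vert_erase_eq_iff {S : Finset (Fin p ×ₗ V)} {a : Fin p ×ₗ V} (ha : a ∈ S) :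
    vert (S.erase a) = vert S ↔ (ofLex a).2 ∈ vert (S.erase a) := by
  constructor
  · intro h
    rw [h]
    exact mem_vert.2 ⟨a, ha, rfl⟩
  · intro h
    conv_rhs => rw [← Finset.insert_erase ha, vert_insert, Finset.insert_eq_of_mem h]

/-- The number of sites of `S` that precede `a`: the exponent of the Jordan–Wigner sign. -/
def before (a : Fin p ×ₗ V) (S : Finset (Fin p ×ₗ V)) : ℕ := (S.filter (· < a)).card

theorem before_siteSet (g : Fin p → Finset V) (j : Fin p) (x : V) :
    before (toLex (j, x)) (siteSet g) =
      ∑ i ∈ Finset.univ.filter (· < j), (g i).card + ((g j).filter (· < x)).card := by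
  have hj : ((g j).filter (· < x)).card =
      ∑ i, if i = j then ((g i).filter (· < x)).card else 0 := by simp
  rw [before, Finset.card_filter, sum_siteSet, Finset.sum_filter, hj,
    ← Finset.sum_add_distrib]
  refine Finset.sum_congr rfl fun i _ => ?_
  simp only [Prod.Lex.toLex_lt_toLex]
  rcases lt_trichotomy i j with h | rfl | h
  · simp [h, h.ne]
  · simp
  · simp [h.not_gt, h.ne']

theorem before_insert {a b : Fin p ×ₗ V} {S : Finset (Fin p ×ₗ V)} (hb : b ∉ S) :
    before a (insert b S) = before a S + if b < a then 1 else 0 := by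
  unfold before
  rw [Finset.filter_insert]
  split_ifs with h
  · rw [Finset.card_insert_of_notMem (by simp [hb])]
  · rfl

theorem before_erase {a b : Fin p ×ₗ V} {S : Finset (Fin p ×ₗ V)} (hb : b ∈ S) :
    before a S = before a (S.erase b) + if b < a then 1 else 0 := by
  conv_lhs => rw [← Finset.insert_erase hb]
  exact before_insert (Finset.notMem_erase _ _)

theorem before_union {a : Fin p ×ₗ V} {S T : Finset (Fin p ×ₗ V)} (h : Disjoint S T) :
    before a (S ∪ T) = before a S + before a T := by
  unfold before
  rw [Finset.filter_union, Finset.card_union_of_disjoint]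
  exact Finset.disjoint_filter_filter h

/-- The number of pairs `(a, b)` in `S × T` with `b < a`: the exponent of the sign in `⋆`. -/
def inversions (S T : Finset (Fin p ×ₗ V)) : ℕ := ∑ a ∈ S, before a T

theorem starSign_eq {M : DiscreteComplex V} (e f : Fin p → M.Simplex) :
    starSign e f = inversions (siteSet fun i => (e i).1) (siteSet fun i => (f i).1) := by
  unfold starSign inversions before
  rw [sum_siteSet]
  refine Finset.sum_congr rfl fun i _ => ?_
  simp only [Finset.card_filter, sum_siteSet, Finset.sum_product, Prod.Lex.toLex_lt_toLex]
  rw [Finset.sum_comm]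

theorem inversions_insert_left {b : Fin p ×ₗ V} {S T : Finset (Fin p ×ₗ V)} (hb : b ∉ S) :
    inversions (insert b S) T = before b T + inversions S T :=
  Finset.sum_insert hb

theorem inversions_insert_right {b : Fin p ×ₗ V} {S T : Finset (Fin p ×ₗ V)} (hb : b ∉ T)
    (hbS : b ∉ S) :
    inversions S (insert b T) + before b S = inversions S T + S.card := by
  unfold inversions
  simp only [before_insert hb, Finset.sum_add_distrib]
  have h : ∑ a ∈ S, (if b < a then 1 else 0) + before b S = S.card := by
    rw [before, Finset.card_filter, ← Finset.sum_add_distrib, Finset.card_eq_sum_ones]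
    refine Finset.sum_congr rfl fun a ha => ?_
    have : a ≠ b := fun h => hbS (h ▸ ha)
    rcases lt_or_gt_of_ne this with h | h
    · simp [h, h.not_gt]
    · simp [h, h.not_gt]
  omega

/-- The sign with which the lifts of `d` and `∂` add the site `a` to `S`, or remove it from `S`: the
Jordan–Wigner sign times `(-1) ^ (p + j)`, where `j` is the place of `a`. -/
def sgn (𝕜 : Type*) [RCLike 𝕜] (a : Fin p ×ₗ V) (S : Finset (Fin p ×ₗ V)) : 𝕜 :=
  (-1) ^ (p + ((ofLex a).1 : ℕ) + before a S)

theorem sgn_mul_self (𝕜 : Type*) [RCLike 𝕜] (a : Fin p ×ₗ V) (S : Finset (Fin p ×ₗ V)) :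
    sgn 𝕜 a S * sgn 𝕜 a S = 1 := by
  unfold sgn
  rw [← mul_pow]
  simp

theorem before_insert_self (a : Fin p ×ₗ V) (S : Finset (Fin p ×ₗ V)) :
    before a (insert a S) = before a S := by
  unfold before
  rw [Finset.filter_insert, if_neg (lt_irrefl a)]

theorem before_erase_self (a : Fin p ×ₗ V) (S : Finset (Fin p ×ₗ V)) :
    before a (S.erase a) = before a S := by
  by_cases h : a ∈ S
  · conv_rhs => rw [← Finset.insert_erase h, before_insert_self]
  · rw [Finset.erase_eq_of_notMem h]

theorem sgn_insert_self (𝕜 : Type*) [RCLike 𝕜] (a : Fin p ×ₗ V) (S : Finset (Fin p ×ₗ V)) :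
    sgn 𝕜 a (insert a S) = sgn 𝕜 a S := by
  rw [sgn, before_insert_self, sgn]

theorem sgn_erase_self (𝕜 : Type*) [RCLike 𝕜] (a : Fin p ×ₗ V) (S : Finset (Fin p ×ₗ V)) :
    sgn 𝕜 a (S.erase a) = sgn 𝕜 a S := by
  rw [sgn, before_erase_self, sgn]

/-- The anticommutation relation: adding `b` and then removing `a` differs by the sign `-1` from
removing `a` and then adding `b`. -/
theorem sgn_anticomm (𝕜 : Type*) [RCLike 𝕜] {a b : Fin p ×ₗ V} {S : Finset (Fin p ×ₗ V)}
    (ha : a ∈ S) (hb : b ∉ S) :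
    sgn 𝕜 b S * sgn 𝕜 a (insert b S) = -(sgn 𝕜 a S * sgn 𝕜 b (S.erase a)) := by
  have hab : a ≠ b := fun h => hb (h ▸ ha)
  unfold sgn
  rw [before_insert hb, before_erase (a := b) ha]
  rcases lt_or_gt_of_ne hab with h | h
  · simp only [h, h.not_gt, if_true, if_false]
    ring
  · simp only [h, h.not_gt, if_true, if_false]
    ring

end Sites

/-! ### The localized operators on sets of sites -/

section Vec

variable {V : Type*} [LinearOrder V] {M : DiscreteComplex V} {𝕜 : Type*} [RCLike 𝕜] {p : ℕ}

/-- The set of sites of a tuple of simplexes. -/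
def sites (e : Fin p → M.Simplex) : Finset (Fin p ×ₗ V) := siteSet fun i => (e i).1

theorem mem_sites {e : Fin p → M.Simplex} {a : Fin p ×ₗ V} :
    a ∈ sites e ↔ (ofLex a).2 ∈ (e (ofLex a).1).1 := mem_siteSet

theorem vert_sites (e : Fin p → M.Simplex) : vert (sites e) = support e := by
  ext x
  simp only [mem_vert, support, Finset.mem_biUnion, Finset.mem_univ, true_and, mem_sites]
  constructor
  · rintro ⟨a, ha, rfl⟩
    exact ⟨_, ha⟩
  · rintro ⟨i, hi⟩
    exact ⟨toLex (i, x), hi, rfl⟩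

theorem exists_sites_eq {S : Finset (Fin p ×ₗ V)} (h : vert S ∈ M.faces) :
    ∃ e : Fin p → M.Simplex, sites e = S :=
  ⟨fun i => ⟨slice S i, M.down_closed _ h _ (slice_subset_vert S i)⟩, siteSet_slice S⟩

variable (M 𝕜) in
/-- The basis vector of the tuple encoded by a set of sites, and `0` if some slice is not a
simplex. -/
noncomputable def vec (S : Finset (Fin p ×ₗ V)) : M.TensorForms 𝕜 p := tupleVec M 𝕜 (slice S)

theorem vec_sites (e : Fin p → M.Simplex) : vec M 𝕜 (sites e) = Finsupp.single e 1 := by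
  unfold vec tupleVec sites
  rw [slice_siteSet, dif_pos fun i => (e i).2]

theorem vec_eq_zero_or (S : Finset (Fin p ×ₗ V)) :
    (vec M 𝕜 S = 0) ∨ ∃ e : Fin p → M.Simplex, sites e = S := by
  by_cases h : ∀ i, slice S i ∈ M.faces
  · exact .inr ⟨fun i => ⟨slice S i, h i⟩, siteSet_slice S⟩
  · exact .inl (dif_neg h)

/-- Only the place `j` of `e` is replaced; the other entries are simplexes anyway, so the result is
`0` exactly when `t` is not a simplex. -/
theorem mapDomain_update_formVec (e : Fin p → M.Simplex) (j : Fin p) (t : Finset V) :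
    Finsupp.mapDomain (fun s : M.Simplex => Function.update e j s) (formVec M 𝕜 t) =
      tupleVec M 𝕜 (Function.update (fun i => (e i).1) j t) := by
  unfold formVec tupleVec
  by_cases h : t ∈ M.faces
  · have h' : ∀ i, Function.update (fun i => (e i).1) j t i ∈ M.faces := by
      intro i
      rcases eq_or_ne i j with rfl | hij
      · simp [h]
      · simp [hij]
    rw [dif_pos h, dif_pos h', Finsupp.mapDomain_single]
    congr 1
    funext i
    apply Subtype.ext
    rcases eq_or_ne i j with rfl | hij
    · simp
    · simp [hij]
  · rw [dif_neg h, dif_neg, Finsupp.mapDomain_zero]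
    intro h'
    exact h (by simpa using h' j)

/-- The sign in the definition of `lift`, combined with that of `d` (for `s = e j ∪ {x}`) or of `∂`
(for `s = e j`), depends only on the number of sites before `(j, x)`. -/
theorem lift_sign (e : Fin p → M.Simplex) (j : Fin p) (x : V) (s : Finset V)
    (hs : (s.filter (· ≤ x)).card = ((e j).1.filter (· < x)).card + 1) :
    ((-1 : 𝕜) ^ (((p : ℤ) - 1) + ∑ i ∈ Finset.univ.filter (· < j), (((e i).1.card : ℤ) - 1))) *
      beta 𝕜 x s = sgn 𝕜 (toLex (j, x)) (sites e) := by
  have h1 : ∑ i ∈ Finset.univ.filter (· < j), (((e i).1.card : ℤ) - 1) =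
      ((∑ i ∈ Finset.univ.filter (· < j), (e i).1.card : ℕ) : ℤ) - (j : ℕ) := by
    have hj : (Finset.univ.filter (· < j)).card = (j : ℕ) := by
      rw [Finset.filter_gt_eq_Iio, Fin.card_Iio]
    rw [Finset.sum_sub_distrib]
    simp [hj]
  have h2 : ∀ A B : ℕ, (-1 : 𝕜) ^ ((p : ℤ) - 1 + ((A : ℤ) - (j : ℕ))) * (-1) ^ (B + 1) =
      (-1) ^ (p + (j : ℕ) + (A + B)) := by
    intro A B
    have h0 : (-1 : 𝕜) ≠ 0 := by simp
    -- replacing `-j` by `+j` in the exponent changes it by the even number `2 * j`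
    rw [← zpow_natCast, ← zpow_natCast, ← zpow_add₀ h0,
      show ((p + (j : ℕ) + (A + B) : ℕ) : ℤ) =
        ((p : ℤ) - 1 + ((A : ℤ) - (j : ℕ)) + (B + 1 : ℕ)) + 2 * (j : ℕ) by push_cast; ring,
      zpow_add₀ h0 _ (2 * _), zpow_mul]
    simp
  rw [h1, beta, hs, h2, sgn, sites, before_siteSet]
  rfl

theorem lift_d_single (e : Fin p → M.Simplex) :
    lift p (d M 𝕜) (Finsupp.single e 1) =
      ∑ a ∈ siteSet (fun j => M.vertices \ (e j).1),
        sgn 𝕜 a (sites e) • vec M 𝕜 (insert a (sites e)) := by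
  rw [lift, Finsupp.linearCombination_single, one_smul, sum_siteSet]
  refine Finset.sum_congr rfl fun j _ => ?_
  rw [d, Finsupp.linearCombination_single, one_smul, Finsupp.mapDomain_finsetSum, Finset.smul_sum]
  refine Finset.sum_congr rfl fun x hx => ?_
  have hx' : x ∉ (e j).1 := (Finset.mem_sdiff.1 hx).2
  rw [Finsupp.mapDomain_smul, mapDomain_update_formVec, smul_smul, lift_sign, vec, slice_insert,
    sites, slice_siteSet]
  rw [Finset.filter_insert, if_pos le_rfl, Finset.card_insert_of_notMem (by simp [hx'])]
  congr 2
  refine Finset.filter_congr fun y hy => ?_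
  have : y ≠ x := fun h => hx' (h ▸ hy)
  exact ⟨fun h => lt_of_le_of_ne h this, le_of_lt⟩

theorem lift_del_single (e : Fin p → M.Simplex) :
    lift p (del M 𝕜) (Finsupp.single e 1) =
      ∑ a ∈ sites e, sgn 𝕜 a (sites e) • vec M 𝕜 ((sites e).erase a) := by
  rw [lift, Finsupp.linearCombination_single, one_smul, sites, sum_siteSet]
  refine Finset.sum_congr rfl fun j _ => ?_
  rw [del, Finsupp.linearCombination_single, one_smul, Finsupp.mapDomain_finsetSum,
    Finset.smul_sum]
  refine Finset.sum_congr rfl fun x hx => ?_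
  rw [Finsupp.mapDomain_smul, mapDomain_update_formVec, smul_smul, lift_sign, vec, slice_erase,
    slice_siteSet, sites]
  rw [← Finset.card_insert_of_notMem (a := x) (s := (e j).1.filter (· < x)) (by simp)]
  congr 1
  ext y
  simp only [Finset.mem_filter, Finset.mem_insert]
  constructor
  · rintro ⟨h1, h2⟩
    rcases h2.eq_or_lt with h | h
    · exact .inl h
    · exact .inr ⟨h1, h⟩
  · rintro (rfl | ⟨h1, h2⟩)
    · exact ⟨hx, le_rfl⟩
    · exact ⟨h1, h2.le⟩

theorem envelope_of_vert_mem {e : Fin p → M.Simplex} (h : vert (sites e) ∈ M.faces) :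
    envelope e = vert (sites e) := by
  rw [vert_sites] at h ⊢
  exact if_pos h

theorem envelope_eq_iff_of_nonempty {e : Fin p → M.Simplex} {σ : Finset V} (hσ : σ.Nonempty)
    (hσM : σ ∈ M.faces) : envelope e = σ ↔ vert (sites e) = σ := by
  rw [vert_sites, envelope]
  split_ifs with h
  · rfl
  · exact ⟨fun h' => absurd hσ (by simp [← h']), fun h' => absurd (h' ▸ hσM) h⟩

theorem filter_vec (S : Finset (Fin p ×ₗ V)) (σ : Finset V) (P : Prop) [Decidable P]
    (h : ∀ e : Fin p → M.Simplex, sites e = S → (envelope e = σ ↔ P)) :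
    (vec M 𝕜 S).filter (fun e => envelope e = σ) = if P then vec M 𝕜 S else 0 := by
  rcases vec_eq_zero_or (M := M) (𝕜 := 𝕜) S with h0 | ⟨e, rfl⟩
  · rw [h0, Finsupp.filter_zero, ite_self]
  · rw [vec_sites]
    split_ifs with hP
    · exact Finsupp.filter_single_of_pos _ ((h e rfl).2 hP)
    · exact Finsupp.filter_single_of_neg _ (fun h' => hP ((h e rfl).1 h'))

theorem filter_sum_smul {ι E : Type*} (s : Finset ι) (c : ι → 𝕜) (v : ι → E →₀ 𝕜)
    (P : E → Prop) [DecidablePred P] :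
    (∑ i ∈ s, c i • v i).filter P = ∑ i ∈ s, c i • (v i).filter P := by
  classical
  induction s using Finset.induction_on with
  | empty => exact Finsupp.filter_zero _
  | insert i s hi ih =>
    rw [Finset.sum_insert hi, Finset.sum_insert hi, Finsupp.filter_add, Finsupp.filter_smul, ih]

variable (p) in
/-- All the `p · #σ` sites over a set `σ` of vertices. -/
def sitesOver (σ : Finset V) : Finset (Fin p ×ₗ V) := siteSet fun _ => σ

theorem mem_sitesOver {σ : Finset V} {a : Fin p ×ₗ V} :
    a ∈ sitesOver p σ ↔ (ofLex a).2 ∈ σ := mem_siteSet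

theorem card_sitesOver (σ : Finset V) : (sitesOver p σ).card = p * σ.card := by
  simp [sitesOver, card_siteSet]

/-- The localized differential adds sites over the vertices already present. This holds for the
empty set of sites as well: a tuple with empty envelope that is not a tuple of empty sets does not
occur in its differential, since a single vertex of `M` is a simplex. -/
theorem localize_d_vec {S : Finset (Fin p ×ₗ V)} (hS : vert S ∈ M.faces) :
    localize (lift p (d M 𝕜)) (vec M 𝕜 S) =
      ∑ a ∈ sitesOver p (vert S) \ S, sgn 𝕜 a S • vec M 𝕜 (insert a S) := by
  obtain ⟨e, rfl⟩ := exists_sites_eq hS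
  rw [vec_sites, localize, Finsupp.linearCombination_single, one_smul, lift_d_single,
    filter_sum_smul]
  have key : ∀ a : Fin p ×ₗ V, (vec M 𝕜 (insert a (sites e))).filter
      (fun e' => envelope e' = envelope e) =
      if (ofLex a).2 ∈ vert (sites e) then vec M 𝕜 (insert a (sites e)) else 0 := by
    intro a
    refine filter_vec _ _ _ fun f hf => ?_
    rw [envelope_of_vert_mem hS]
    constructor
    · intro h
      by_contra ha
      by_cases hfM : vert (sites f) ∈ M.faces
      · rw [envelope_of_vert_mem hfM, hf, vert_insert] at h
        exact ha (h ▸ Finset.mem_insert_self _ _)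
      · -- here the envelope of `f` is empty, so all simplexes of `e` are empty
        have hfe : envelope f = ∅ := if_neg (by rwa [← vert_sites])
        rw [hfe] at h
        apply hfM
        rw [hf, vert_insert, ← h]
        refine M.down_closed _ (f (ofLex a).1).2 _ ?_
        have : a ∈ sites f := by rw [hf]; exact Finset.mem_insert_self _ _
        simpa using mem_sites.1 this
    · intro h
      have h' : vert (sites f) = vert (sites e) := by
        rw [hf, vert_insert, Finset.insert_eq_of_mem h]
      rw [envelope_of_vert_mem (by rw [h']; exact hS), h']
  simp only [key, smul_ite, smul_zero]
  rw [← Finset.sum_filter]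
  congr 1
  ext a
  simp only [Finset.mem_filter, mem_siteSet, Finset.mem_sdiff, mem_sitesOver, mem_sites]
  constructor
  · rintro ⟨⟨_, h⟩, h'⟩
    exact ⟨h', h⟩
  · rintro ⟨h, h'⟩
    exact ⟨⟨Finset.mem_biUnion.2 ⟨_, hS, h⟩, h'⟩, h⟩

/-- The localized co-differential removes the sites that are not the only ones over their vertex. -/
theorem localize_del_vec {S : Finset (Fin p ×ₗ V)} (hS : vert S ∈ M.faces) :
    localize (lift p (del M 𝕜)) (vec M 𝕜 S) =
      ∑ a ∈ S.filter (fun a => (ofLex a).2 ∈ vert (S.erase a)),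
        sgn 𝕜 a S • vec M 𝕜 (S.erase a) := by
  obtain ⟨e, rfl⟩ := exists_sites_eq hS
  rw [vec_sites, localize, Finsupp.linearCombination_single, one_smul, lift_del_single,
    filter_sum_smul, Finset.sum_filter]
  refine Finset.sum_congr rfl fun a ha => ?_
  rw [filter_vec _ _ ((ofLex a).2 ∈ vert ((sites e).erase a)), smul_ite, smul_zero]
  intro f hf
  rw [envelope_of_vert_mem hS, ← vert_erase_eq_iff ha, ← hf, envelope_of_vert_mem]
  rw [hf]
  exact M.down_closed _ hS _ (vert_erase_subset _ _)

end Vec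

/-! ### The local Laplacian on sets of sites -/

section Laplacian

variable {V : Type*} [LinearOrder V] {M : DiscreteComplex V} {𝕜 : Type*} [RCLike 𝕜] {p : ℕ}

/-- The sites of `S` that are the only ones over their vertex. -/
def freeSites (S : Finset (Fin p ×ₗ V)) : Finset (Fin p ×ₗ V) :=
  S.filter fun a => (ofLex a).2 ∉ vert (S.erase a)

variable (M 𝕜) in
/-- The vector obtained from `S` by removing the site `a` and then adding the site `b`, with the
signs of `∂` and `d`. -/
noncomputable def hop (S : Finset (Fin p ×ₗ V)) (a b : Fin p ×ₗ V) : M.TensorForms 𝕜 p :=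
  (sgn 𝕜 a S * sgn 𝕜 b (S.erase a)) • vec M 𝕜 (insert b (S.erase a))

theorem hop_self {S : Finset (Fin p ×ₗ V)} {a : Fin p ×ₗ V} (ha : a ∈ S) :
    hop M 𝕜 S a a = vec M 𝕜 S := by
  rw [hop, sgn_erase_self, sgn_mul_self, one_smul, Finset.insert_erase ha]

theorem localize_d_localize_del_vec {S : Finset (Fin p ×ₗ V)} (hS : vert S ∈ M.faces) :
    localize (lift p (d M 𝕜)) (localize (lift p (del M 𝕜)) (vec M 𝕜 S)) =
      ∑ a ∈ S.filter (fun a => (ofLex a).2 ∈ vert (S.erase a)),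
        (vec M 𝕜 S + ∑ b ∈ sitesOver p (vert S) \ S, hop M 𝕜 S a b) := by
  rw [localize_del_vec hS, map_sum]
  refine Finset.sum_congr rfl fun a ha => ?_
  obtain ⟨ha, ha'⟩ := Finset.mem_filter.1 ha
  have hv := (vert_erase_eq_iff ha).2 ha'
  -- the term of `a` itself puts the removed site back and gives `vec M 𝕜 S`
  have hK : sitesOver p (vert S) \ S.erase a = insert a (sitesOver p (vert S) \ S) := by
    rw [Finset.sdiff_erase]
    exact mem_sitesOver.2 (mem_vert.2 ⟨a, ha, rfl⟩)
  rw [map_smul, localize_d_vec (by rwa [hv]), hv, hK, Finset.smul_sum,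
    Finset.sum_insert (by simp [ha])]
  simp only [smul_smul]
  rw [← hop, hop_self ha]
  rfl

/-- The terms over sites `a` that are not free cancel against `localize_d_localize_del_vec`. The
remaining ones come from free sites `a` that can be removed after `b` has been added over the same
vertex. -/
theorem localize_del_localize_d_vec {S : Finset (Fin p ×ₗ V)} (hS : vert S ∈ M.faces) :
    localize (lift p (del M 𝕜)) (localize (lift p (d M 𝕜)) (vec M 𝕜 S)) =
      ∑ b ∈ sitesOver p (vert S) \ S,
        (vec M 𝕜 S - (∑ a ∈ S.filter (fun a => (ofLex a).2 ∈ vert (S.erase a)), hop M 𝕜 S a b +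
          ∑ a ∈ freeSites S, if (ofLex b).2 = (ofLex a).2 then hop M 𝕜 S a b else 0)) := by
  rw [localize_d_vec hS, map_sum]
  refine Finset.sum_congr rfl fun b hb => ?_
  obtain ⟨hbK, hbS⟩ := Finset.mem_sdiff.1 hb
  have hv : vert (insert b S) = vert S := by
    rw [vert_insert, Finset.insert_eq_of_mem (mem_sitesOver.1 hbK)]
  have hF : (insert b S).filter (fun a => (ofLex a).2 ∈ vert ((insert b S).erase a)) =
      insert b (S.filter (fun a => (ofLex a).2 ∈ vert (S.erase a)) ∪
        (freeSites S).filter fun a => (ofLex b).2 = (ofLex a).2) := by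
    ext a
    rcases eq_or_ne a b with rfl | hab
    · simp [Finset.erase_insert hbS, mem_sitesOver.1 hbK]
    · rw [Finset.mem_filter, Finset.erase_insert_of_ne hab.symm, vert_insert]
      simp only [Finset.mem_insert, hab, false_or, Finset.mem_union, Finset.mem_filter, freeSites,
        eq_comm (a := (ofLex b).2)]
      tauto
  have hd : Disjoint (S.filter (fun a => (ofLex a).2 ∈ vert (S.erase a)))
      ((freeSites S).filter fun a => (ofLex b).2 = (ofLex a).2) :=
    Finset.disjoint_left.2 fun a h1 h2 =>
      (Finset.mem_filter.1 (Finset.mem_filter.1 h2).1).2 (Finset.mem_filter.1 h1).2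
  have hterm : ∀ a ∈ S, (sgn 𝕜 b S * sgn 𝕜 a (insert b S)) • vec M 𝕜 ((insert b S).erase a) =
      -hop M 𝕜 S a b := by
    intro a ha
    have hab : b ≠ a := fun h => hbS (h ▸ ha)
    rw [sgn_anticomm 𝕜 ha hbS, Finset.erase_insert_of_ne hab, neg_smul, hop]
  rw [map_smul, localize_del_vec (by rwa [hv]), hF, Finset.smul_sum,
    Finset.sum_insert (by simp [hbS, freeSites])]
  simp only [smul_smul]
  rw [sgn_insert_self, sgn_mul_self, one_smul, Finset.erase_insert hbS, Finset.sum_union hd,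
    sub_eq_add_neg, neg_add, ← Finset.sum_neg_distrib, ← Finset.sum_filter,
    ← Finset.sum_neg_distrib]
  congr 2
  · exact Finset.sum_congr rfl fun a ha => hterm a (Finset.mem_filter.1 ha).1
  · exact Finset.sum_congr rfl fun a ha =>
      hterm a (Finset.mem_filter.1 (Finset.mem_filter.1 ha).1).1

theorem sum_hop_free {S : Finset (Fin p ×ₗ V)} {a : Fin p ×ₗ V} (ha : a ∈ freeSites S) :
    ∑ j : Fin p, hop M 𝕜 S a (toLex (j, (ofLex a).2)) =
      vec M 𝕜 S + ∑ b ∈ sitesOver p (vert S) \ S,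
        if (ofLex b).2 = (ofLex a).2 then hop M 𝕜 S a b else 0 := by
  obtain ⟨haS, ha'⟩ := Finset.mem_filter.1 ha
  have h1 : ∑ j : Fin p, hop M 𝕜 S a (toLex (j, (ofLex a).2)) =
      ∑ b ∈ sitesOver p {(ofLex a).2}, hop M 𝕜 S a b := by
    rw [sitesOver, sum_siteSet]
    simp
  have h2 : sitesOver p {(ofLex a).2} =
      insert a ((sitesOver p (vert S) \ S).filter fun b => (ofLex b).2 = (ofLex a).2) := by
    ext b
    simp only [mem_sitesOver, Finset.mem_singleton, Finset.mem_insert, Finset.mem_filter,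
      Finset.mem_sdiff]
    constructor
    · intro h
      rcases eq_or_ne b a with hba | hba
      · exact .inl hba
      · refine .inr ⟨⟨?_, fun hb => ha' ?_⟩, h⟩
        · rw [h]
          exact mem_vert.2 ⟨a, haS, rfl⟩
        · exact mem_vert.2 ⟨b, Finset.mem_erase.2 ⟨hba, hb⟩, h⟩
    · rintro (rfl | h)
      · rfl
      · exact h.2
  rw [h1, h2, Finset.sum_insert (by simp [haS]), hop_self haS, Finset.sum_filter]

/-- The local Laplacian is `p · #(vert S)` minus the sum of all moves of one free vertex to any
place, the present one included. -/
theorem localLaplacian_vec {S : Finset (Fin p ×ₗ V)} (hS : vert S ∈ M.faces) :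
    M.localLaplacian 𝕜 p (vec M 𝕜 S) = ((p : 𝕜) * (vert S).card) • vec M 𝕜 S -
      ∑ a ∈ freeSites S, ∑ j : Fin p, hop M 𝕜 S a (toLex (j, (ofLex a).2)) := by
  have hsub : S ⊆ sitesOver p (vert S) :=
    fun a ha => mem_sitesOver.2 (mem_vert.2 ⟨a, ha, rfl⟩)
  -- the first two numbers count the diagonal terms of `[d][∂]` and of `[∂][d]`
  have hcard : (S.filter (fun a => (ofLex a).2 ∈ vert (S.erase a))).card +
      (sitesOver p (vert S) \ S).card + (freeSites S).card = p * (vert S).card := by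
    rw [add_right_comm, freeSites, Finset.card_filter_add_card_filter_not,
      add_comm, Finset.card_sdiff_add_card_eq_card hsub, card_sitesOver]
  rw [localLaplacian, LinearMap.add_apply, LinearMap.comp_apply, LinearMap.comp_apply,
    localize_d_localize_del_vec hS, localize_del_localize_d_vec hS,
    Finset.sum_congr rfl fun a ha => sum_hop_free ha]
  simp only [Finset.sum_add_distrib, Finset.sum_sub_distrib, Finset.sum_const]
  rw [Finset.sum_comm (s := sitesOver p (vert S) \ S),
    Finset.sum_comm (s := sitesOver p (vert S) \ S), ← Nat.cast_mul, ← hcard]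
  push_cast
  simp only [add_smul, ← Nat.cast_smul_eq_nsmul 𝕜]
  abel

end Laplacian

/-! ### The Leibniz rule -/

section Star

variable {V : Type*} [LinearOrder V] {M : DiscreteComplex V} {𝕜 : Type*} [RCLike 𝕜] {p : ℕ}

variable (M 𝕜 p) in
/-- The `⋆`-product as a bilinear map. -/
noncomputable def starHom : M.TensorForms 𝕜 p →ₗ[𝕜] M.TensorForms 𝕜 p →ₗ[𝕜] M.TensorForms 𝕜 p :=
  Finsupp.linearCombination 𝕜 fun e : Fin p → M.Simplex =>
    Finsupp.linearCombination 𝕜 fun f : Fin p → M.Simplex =>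
      (-1 : 𝕜) ^ starSign e f • tupleVec M 𝕜 fun i => (e i).1 ∪ (f i).1

theorem starHom_apply (u v : M.TensorForms 𝕜 p) : starHom M 𝕜 p u v = star u v := by
  rw [starHom, Finsupp.linearCombination_apply, Finsupp.sum, LinearMap.sum_apply, star, Finsupp.sum]
  refine Finset.sum_congr rfl fun e _ => ?_
  rw [LinearMap.smul_apply, Finsupp.linearCombination_apply, Finsupp.smul_sum]
  refine Finset.sum_congr rfl fun f _ => ?_
  simp only [smul_smul, mul_assoc]

theorem slice_union (S T : Finset (Fin p ×ₗ V)) (i : Fin p) :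
    slice (S ∪ T) i = slice S i ∪ slice T i := by
  ext x
  simp [mem_slice]

theorem starHom_vec {S T : Finset (Fin p ×ₗ V)} (hS : vert S ∈ M.faces) (hT : vert T ∈ M.faces) :
    starHom M 𝕜 p (vec M 𝕜 S) (vec M 𝕜 T) = (-1 : 𝕜) ^ inversions S T • vec M 𝕜 (S ∪ T) := by
  obtain ⟨e, rfl⟩ := exists_sites_eq hS
  obtain ⟨f, rfl⟩ := exists_sites_eq hT
  rw [vec_sites, vec_sites, starHom, Finsupp.linearCombination_single, one_smul,
    Finsupp.linearCombination_single, one_smul, starSign_eq]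
  unfold vec
  congr 2
  funext i
  rw [slice_union, sites, sites, slice_siteSet, slice_siteSet]

theorem neg_one_pow_congr_mod_two {R : Type*} [Ring R] {m n : ℕ}
    (h : m % 2 = n % 2) : (-1 : R) ^ m = (-1) ^ n := by
  rw [neg_one_pow_eq_pow_mod_two, h, ← neg_one_pow_eq_pow_mod_two]

theorem disjoint_of_vert {S T : Finset (Fin p ×ₗ V)} (h : Disjoint (vert S) (vert T)) :
    Disjoint S T :=
  Finset.disjoint_left.2 fun a ha hb =>
    Finset.disjoint_left.1 h (mem_vert.2 ⟨a, ha, rfl⟩) (mem_vert.2 ⟨a, hb, rfl⟩)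

/-- Moving a site of `S` commutes with `⋆`-multiplication by `T` from the right, because `a` and `b`
contribute the same numbers of inversions with `T` as they have predecessors in `T`. -/
theorem sgn_hop_star_left (𝕜 : Type*) [RCLike 𝕜] {S T : Finset (Fin p ×ₗ V)} (hd : Disjoint S T)
    {a b : Fin p ×ₗ V} (ha : a ∈ S) (hbS : b ∉ S.erase a) :
    (-1 : 𝕜) ^ inversions S T * (sgn 𝕜 a (S ∪ T) * sgn 𝕜 b (S.erase a ∪ T)) =
      sgn 𝕜 a S * sgn 𝕜 b (S.erase a) * (-1) ^ inversions (insert b (S.erase a)) T := by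
  have h1 : inversions S T = before a T + inversions (S.erase a) T := by
    conv_lhs => rw [← Finset.insert_erase ha]
    exact inversions_insert_left (Finset.notMem_erase _ _)
  have hd' : Disjoint (S.erase a) T := hd.mono_left (Finset.erase_subset _ _)
  rw [inversions_insert_left hbS, h1]
  unfold sgn
  rw [before_union hd, before_union hd']
  simp only [← pow_add]
  apply neg_one_pow_congr_mod_two
  omega

/-- Moving a site of `T` commutes with `⋆`-multiplication by `S` from the left: the removal and the
addition of a site each contribute the sign `(-1) ^ #S`. -/
theorem sgn_hop_star_right (𝕜 : Type*) [RCLike 𝕜] {S T : Finset (Fin p ×ₗ V)} (hd : Disjoint S T)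
    {a b : Fin p ×ₗ V} (ha : a ∈ T) (hbT : b ∉ T.erase a) (hbS : b ∉ S) :
    (-1 : 𝕜) ^ inversions S T * (sgn 𝕜 a (S ∪ T) * sgn 𝕜 b (S ∪ T.erase a)) =
      sgn 𝕜 a T * sgn 𝕜 b (T.erase a) * (-1) ^ inversions S (insert b (T.erase a)) := by
  have haS : a ∉ S := Finset.disjoint_right.1 hd ha
  have h1 := inversions_insert_right (Finset.notMem_erase a T) haS
  rw [Finset.insert_erase ha] at h1
  have h2 := inversions_insert_right hbT hbS
  have hd' : Disjoint S (T.erase a) := hd.mono_right (Finset.erase_subset _ _)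
  unfold sgn
  rw [before_union hd, before_union hd']
  simp only [← pow_add]
  apply neg_one_pow_congr_mod_two
  omega

theorem freeSites_union_left {S T : Finset (Fin p ×ₗ V)} (h : Disjoint (vert S) (vert T))
    {a : Fin p ×ₗ V} (ha : a ∈ S) : a ∈ freeSites (S ∪ T) ↔ a ∈ freeSites S := by
  have haT : (ofLex a).2 ∉ vert T := Finset.disjoint_left.1 h (mem_vert.2 ⟨a, ha, rfl⟩)
  have haT' : a ∉ T := fun h => haT (mem_vert.2 ⟨a, h, rfl⟩)
  rw [freeSites, freeSites, Finset.mem_filter, Finset.mem_filter, Finset.erase_union_distrib,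
    Finset.erase_eq_of_notMem haT', vert_union]
  simp [ha, haT]

theorem freeSites_union {S T : Finset (Fin p ×ₗ V)} (h : Disjoint (vert S) (vert T)) :
    freeSites (S ∪ T) = freeSites S ∪ freeSites T := by
  ext a
  have hsub : ∀ S : Finset (Fin p ×ₗ V), a ∈ freeSites S → a ∈ S :=
    fun S ha => (Finset.mem_filter.1 ha).1
  rw [Finset.mem_union]
  constructor
  · intro ha
    rcases Finset.mem_union.1 (hsub _ ha) with h' | h'
    · exact .inl ((freeSites_union_left h h').1 ha)
    · rw [Finset.union_comm] at ha
      exact .inr ((freeSites_union_left h.symm h').1 ha)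
  · rintro (ha | ha)
    · exact (freeSites_union_left h (hsub _ ha)).2 ha
    · rw [Finset.union_comm]
      exact (freeSites_union_left h.symm (hsub _ ha)).2 ha

theorem vert_insert_erase {S : Finset (Fin p ×ₗ V)} {a b : Fin p ×ₗ V} (ha : a ∈ S)
    (hab : (ofLex b).2 = (ofLex a).2) : vert (insert b (S.erase a)) = vert S := by
  rw [vert_insert, hab, ← vert_insert, Finset.insert_erase ha]

theorem notMem_erase_of_mem_freeSites {S : Finset (Fin p ×ₗ V)} {a b : Fin p ×ₗ V}
    (ha : a ∈ freeSites S) (hab : (ofLex b).2 = (ofLex a).2) : b ∉ S.erase a :=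
  fun hb => (Finset.mem_filter.1 ha).2 (mem_vert.2 ⟨b, hb, hab⟩)

theorem starHom_hop_left {S T : Finset (Fin p ×ₗ V)} (hS : vert S ∈ M.faces) (hT : vert T ∈ M.faces)
    (h : Disjoint (vert S) (vert T)) {a b : Fin p ×ₗ V} (ha : a ∈ freeSites S)
    (hab : (ofLex b).2 = (ofLex a).2) :
    starHom M 𝕜 p (hop M 𝕜 S a b) (vec M 𝕜 T) =
      (-1 : 𝕜) ^ inversions S T • hop M 𝕜 (S ∪ T) a b := by
  have haS : a ∈ S := (Finset.mem_filter.1 ha).1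
  have haT : a ∉ T := Finset.disjoint_left.1 (disjoint_of_vert h) haS
  rw [hop, hop, map_smul, LinearMap.smul_apply, starHom_vec (by rwa [vert_insert_erase haS hab]) hT,
    smul_smul, smul_smul, Finset.erase_union_distrib, Finset.erase_eq_of_notMem haT,
    sgn_hop_star_left 𝕜 (disjoint_of_vert h) haS (notMem_erase_of_mem_freeSites ha hab),
    Finset.insert_union]

theorem starHom_hop_right {S T : Finset (Fin p ×ₗ V)} (hS : vert S ∈ M.faces)
    (hT : vert T ∈ M.faces) (h : Disjoint (vert S) (vert T)) {a b : Fin p ×ₗ V}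
    (ha : a ∈ freeSites T) (hab : (ofLex b).2 = (ofLex a).2) :
    starHom M 𝕜 p (vec M 𝕜 S) (hop M 𝕜 T a b) =
      (-1 : 𝕜) ^ inversions S T • hop M 𝕜 (S ∪ T) a b := by
  have haT : a ∈ T := (Finset.mem_filter.1 ha).1
  have haS : a ∉ S := Finset.disjoint_right.1 (disjoint_of_vert h) haT
  have hbS : b ∉ S := fun hb =>
    Finset.disjoint_left.1 h (mem_vert.2 ⟨b, hb, hab⟩) (mem_vert.2 ⟨a, haT, rfl⟩)
  rw [hop, hop, map_smul, starHom_vec hS (by rwa [vert_insert_erase haT hab]),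
    smul_smul, smul_smul, Finset.erase_union_distrib, Finset.erase_eq_of_notMem haS,
    sgn_hop_star_right 𝕜 (disjoint_of_vert h) haT (notMem_erase_of_mem_freeSites ha hab) hbS,
    Finset.union_insert]

theorem localLaplacian_starHom_vec {S T : Finset (Fin p ×ₗ V)} (h : Disjoint (vert S) (vert T))
    (hM : vert S ∪ vert T ∈ M.faces) :
    M.localLaplacian 𝕜 p (starHom M 𝕜 p (vec M 𝕜 S) (vec M 𝕜 T)) =
      starHom M 𝕜 p (M.localLaplacian 𝕜 p (vec M 𝕜 S)) (vec M 𝕜 T) +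
        starHom M 𝕜 p (vec M 𝕜 S) (M.localLaplacian 𝕜 p (vec M 𝕜 T)) := by
  have hS : vert S ∈ M.faces := M.down_closed _ hM _ Finset.subset_union_left
  have hT : vert T ∈ M.faces := M.down_closed _ hM _ Finset.subset_union_right
  have hd : Disjoint (freeSites S) (freeSites T) :=
    (disjoint_of_vert h).mono (Finset.filter_subset _ _) (Finset.filter_subset _ _)
  have hl : ∀ a ∈ freeSites S,
      ∑ j : Fin p, starHom M 𝕜 p (hop M 𝕜 S a (toLex (j, (ofLex a).2))) (vec M 𝕜 T) =
      ∑ j : Fin p, (-1 : 𝕜) ^ inversions S T • hop M 𝕜 (S ∪ T) a (toLex (j, (ofLex a).2)) :=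
    fun a ha => Finset.sum_congr rfl fun j _ => starHom_hop_left hS hT h ha rfl
  have hr : ∀ a ∈ freeSites T,
      ∑ j : Fin p, starHom M 𝕜 p (vec M 𝕜 S) (hop M 𝕜 T a (toLex (j, (ofLex a).2))) =
      ∑ j : Fin p, (-1 : 𝕜) ^ inversions S T • hop M 𝕜 (S ∪ T) a (toLex (j, (ofLex a).2)) :=
    fun a ha => Finset.sum_congr rfl fun j _ => starHom_hop_right hS hT h ha rfl
  rw [starHom_vec hS hT, map_smul, localLaplacian_vec (by rwa [vert_union]), localLaplacian_vec hS,
    localLaplacian_vec hT, vert_union, Finset.card_union_of_disjoint h, freeSites_union h,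
    Finset.sum_union hd]
  simp only [map_sub, map_sum, LinearMap.sub_apply, LinearMap.sum_apply, map_smul,
    LinearMap.smul_apply]
  rw [Finset.sum_congr rfl hl, Finset.sum_congr rfl hr, starHom_vec hS hT]
  simp only [← Finset.smul_sum, smul_sub, smul_add]
  rw [smul_comm ((p : 𝕜) * _), smul_comm ((p : 𝕜) * _), Nat.cast_add, mul_add, add_smul, smul_add]
  abel

variable (M 𝕜 p) in
/-- The span of the tuples whose simplexes have the union `A`. -/
noncomputable def supportedOn (A : Finset V) : Submodule 𝕜 (M.TensorForms 𝕜 p) :=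
  Submodule.span 𝕜 {v | ∃ S : Finset (Fin p ×ₗ V), vert S = A ∧ v = vec M 𝕜 S}

theorem vec_mem_supportedOn (S : Finset (Fin p ×ₗ V)) : vec M 𝕜 S ∈ supportedOn M 𝕜 p (vert S) :=
  Submodule.subset_span ⟨S, rfl, rfl⟩

theorem starHom_mem_supportedOn {A B : Finset V} (hA : A ∈ M.faces) (hB : B ∈ M.faces)
    {u v : M.TensorForms 𝕜 p} (hu : u ∈ supportedOn M 𝕜 p A) (hv : v ∈ supportedOn M 𝕜 p B) :
    starHom M 𝕜 p u v ∈ supportedOn M 𝕜 p (A ∪ B) := by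
  have := Submodule.apply_mem_map₂ (starHom M 𝕜 p) hu hv
  rw [supportedOn, supportedOn, Submodule.map₂_span_span] at this
  refine Submodule.span_le.2 ?_ this
  rintro _ ⟨_, ⟨S, rfl, rfl⟩, _, ⟨T, rfl, rfl⟩, rfl⟩
  change starHom M 𝕜 p (vec M 𝕜 S) (vec M 𝕜 T) ∈ supportedOn M 𝕜 p (vert S ∪ vert T)
  rw [starHom_vec hA hB, ← vert_union]
  exact Submodule.smul_mem _ _ (vec_mem_supportedOn _)

theorem localLaplacian_starHom {A B : Finset V} (h : Disjoint A B) (hM : A ∪ B ∈ M.faces)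
    {u v : M.TensorForms 𝕜 p} (hu : u ∈ supportedOn M 𝕜 p A) (hv : v ∈ supportedOn M 𝕜 p B) :
    M.localLaplacian 𝕜 p (starHom M 𝕜 p u v) =
      starHom M 𝕜 p (M.localLaplacian 𝕜 p u) v + starHom M 𝕜 p u (M.localLaplacian 𝕜 p v) := by
  induction hu using Submodule.span_induction with
  | mem x hx =>
    obtain ⟨S, rfl, rfl⟩ := hx
    induction hv using Submodule.span_induction with
    | mem x hx =>
      obtain ⟨T, rfl, rfl⟩ := hx
      exact localLaplacian_starHom_vec h hM
    | zero => simp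
    | add x y _ _ hx hy =>
      simp only [map_add, hx, hy]
      abel
    | smul c x _ hx => simp only [map_smul, hx, smul_add]
  | zero => simp
  | add x y _ _ hx hy =>
    simp only [map_add, LinearMap.add_apply, hx, hy]
    abel
  | smul c x _ hx => simp only [map_smul, LinearMap.smul_apply, hx, smul_add]

end Star

/-! ### The eigenvectors -/

section Eigenvectors

variable {V : Type*} [LinearOrder V] {M : DiscreteComplex V} {𝕜 : Type*} [RCLike 𝕜] {p : ℕ}

theorem vert_singleton (a : Fin p ×ₗ V) : vert {a} = {(ofLex a).2} := by
  simp [vert]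

theorem point_eq_vec (j : Fin p) (x : V) : point M 𝕜 p x j = vec M 𝕜 {toLex (j, x)} := by
  unfold point vec
  congr 1
  funext i
  ext y
  rw [mem_slice, Finset.mem_singleton, EmbeddingLike.apply_eq_iff_eq, Prod.mk.injEq]
  split_ifs with h
  · simp [Fin.ext h]
  · have h' : i ≠ j := fun h' => h (congrArg Fin.val h')
    simp [h']

theorem ket_zero_eq_sum (x : V) :
    ket M 𝕜 p x 0 = ∑ j : Fin p, (-1 : 𝕜) ^ (j : ℕ) • vec M 𝕜 {toLex (j, x)} := by
  rw [ket, if_pos rfl, ← Fin.sum_univ_eq_sum_range (fun j => (-1 : 𝕜) ^ j • point M 𝕜 p x j)]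
  simp only [point_eq_vec]

/-- On the tuples with the single vertex `x`, the local Laplacian is `p` minus a rank-one operator
with image spanned by `|0⟩_x`. -/
theorem localLaplacian_vec_singleton {x : V} (hx : {x} ∈ M.faces) (j : Fin p) :
    M.localLaplacian 𝕜 p (vec M 𝕜 {toLex (j, x)}) =
      (p : 𝕜) • vec M 𝕜 {toLex (j, x)} - (-1 : 𝕜) ^ (j : ℕ) • ket M 𝕜 p x 0 := by
  have hfree : freeSites ({toLex (j, x)} : Finset (Fin p ×ₗ V)) = {toLex (j, x)} := by
    ext a
    simp only [freeSites, Finset.mem_filter, Finset.mem_singleton, and_iff_left_iff_imp]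
    rintro rfl
    simp [vert]
  have hhop : ∀ i : Fin p, hop M 𝕜 {toLex (j, x)} (toLex (j, x)) (toLex (i, x)) =
      (-1 : 𝕜) ^ (j : ℕ) • (-1 : 𝕜) ^ (i : ℕ) • vec M 𝕜 {toLex (i, x)} := by
    intro i
    rw [hop, ← Finset.insert_empty, sgn_insert_self, Finset.erase_insert (Finset.notMem_empty _),
      smul_smul]
    congr 1
    simp only [sgn, before, Finset.filter_empty, Finset.card_empty, ofLex_toLex]
    rw [← pow_add, ← pow_add]
    apply neg_one_pow_congr_mod_two
    omega
  rw [localLaplacian_vec (by rwa [vert_singleton]), hfree, Finset.sum_singleton, vert_singleton,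
    ket_zero_eq_sum, Finset.smul_sum]
  simp [hhop]

theorem localLaplacian_ket {x : V} (hx : {x} ∈ M.faces) (m : Fin p) :
    M.localLaplacian 𝕜 p (ket M 𝕜 p x m) =
      ((p : 𝕜) * if (m : ℕ) = 0 then 0 else 1) • ket M 𝕜 p x m := by
  have hsq : ∀ i : ℕ, (-1 : 𝕜) ^ i * (-1) ^ i = 1 := fun i => by rw [← mul_pow]; simp
  by_cases hm : (m : ℕ) = 0
  · rw [if_pos hm, hm, mul_zero, zero_smul]
    conv_lhs => rw [ket_zero_eq_sum]
    simp only [map_sum, map_smul, localLaplacian_vec_singleton hx, smul_sub, smul_smul, hsq,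
      one_smul, Finset.sum_sub_distrib, Finset.sum_const, Finset.card_univ, Fintype.card_fin]
    rw [ket_zero_eq_sum, ← Nat.cast_smul_eq_nsmul 𝕜, Finset.smul_sum]
    simp only [smul_smul, mul_comm (p : 𝕜), sub_self]
  · have hm' : (m : ℕ) - 1 < p := by omega
    have h1 : point M 𝕜 p x ((m : ℕ) - 1) = vec M 𝕜 {toLex ((⟨m - 1, hm'⟩ : Fin p), x)} :=
      point_eq_vec ⟨m - 1, hm'⟩ x
    rw [if_neg hm, mul_one]
    conv_lhs => rw [ket, if_neg hm]
    conv_rhs => rw [ket, if_neg hm]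
    rw [h1, point_eq_vec, map_sub, map_smul, map_smul, localLaplacian_vec_singleton hx,
      localLaplacian_vec_singleton hx]
    simp only [smul_sub, smul_smul, hsq, one_smul, mul_comm (p : 𝕜)]
    abel

theorem vec_singleton_mem_supportedOn (x : V) (j : Fin p) :
    vec M 𝕜 {toLex (j, x)} ∈ supportedOn M 𝕜 p {x} := by
  have := vec_mem_supportedOn (M := M) (𝕜 := 𝕜) ({toLex (j, x)} : Finset (Fin p ×ₗ V))
  rwa [vert_singleton] at this

theorem point_mem_supportedOn (x : V) {j : ℕ} (hj : j < p) :
    point M 𝕜 p x j ∈ supportedOn M 𝕜 p {x} := by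
  rw [point_eq_vec ⟨j, hj⟩]
  exact vec_singleton_mem_supportedOn x _

theorem ket_mem_supportedOn (x : V) (m : Fin p) : ket M 𝕜 p x m ∈ supportedOn M 𝕜 p {x} := by
  unfold ket
  split_ifs
  · exact Submodule.sum_mem _ fun j hj =>
      Submodule.smul_mem _ _ (point_mem_supportedOn x (Finset.mem_range.1 hj))
  · exact Submodule.sub_mem _ (Submodule.smul_mem _ _ (point_mem_supportedOn x (by omega)))
      (Submodule.smul_mem _ _ (point_mem_supportedOn x m.2))

theorem image_univ_castSucc {k : ℕ} (t : Fin (k + 1) → V) :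
    Finset.univ.image t = Finset.univ.image (fun i : Fin k => t i.castSucc) ∪ {t (Fin.last k)} := by
  ext x
  simp only [Finset.mem_image, Finset.mem_univ, true_and, Finset.mem_union, Finset.mem_singleton]
  constructor
  · rintro ⟨i, rfl⟩
    induction i using Fin.lastCases with
    | last => exact .inr rfl
    | cast i => exact .inl ⟨i, rfl⟩
  · rintro (⟨i, rfl⟩ | rfl)
    · exact ⟨_, rfl⟩
    · exact ⟨_, rfl⟩

variable (𝕜) in
theorem eigenvector_succ {k : ℕ} (c : Fin p → M.Simplex) (t : Fin (k + 1) → V)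
    (m : Fin (k + 1) → Fin p) :
    eigenvector 𝕜 c t m =
      starHom M 𝕜 p (eigenvector 𝕜 c (fun i => t i.castSucc) fun i => m i.castSucc)
        (ket M 𝕜 p (t (Fin.last k)) (m (Fin.last k))) := by
  rw [starHom_apply, eigenvector, Fin.foldl_succ_last]
  rfl

theorem localLaplacian_eigenvector {c : Fin p → M.Simplex} (hc : freeSites (sites c) = ∅)
    {k : ℕ} (t : Fin k → V) (ht : Function.Injective t) (htc : ∀ i, t i ∉ support c)
    (hM : support c ∪ Finset.univ.image t ∈ M.faces) (m : Fin k → Fin p) :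
    eigenvector 𝕜 c t m ∈ supportedOn M 𝕜 p (support c ∪ Finset.univ.image t) ∧
      M.localLaplacian 𝕜 p (eigenvector 𝕜 c t m) =
        ((p : 𝕜) * ((support c).card + ∑ i, if (m i : ℕ) = 0 then 0 else 1)) •
          eigenvector 𝕜 c t m := by
  induction k with
  | zero =>
    have h0 : eigenvector 𝕜 c t m = vec M 𝕜 (sites c) := by
      rw [vec_sites, eigenvector, Fin.foldl_zero]
    have hM' : support c ∈ M.faces := M.down_closed _ hM _ Finset.subset_union_left
    rw [← vert_sites] at hM' ⊢
    rw [h0, localLaplacian_vec hM', hc]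
    refine ⟨?_, by simp⟩
    simpa using vec_mem_supportedOn (M := M) (𝕜 := 𝕜) (sites c)
  | succ k ih =>
    rw [image_univ_castSucc, ← Finset.union_assoc] at hM ⊢
    have hM' := M.down_closed _ hM _ Finset.subset_union_left
    have hx : {t (Fin.last k)} ∈ M.faces := M.down_closed _ hM _ Finset.subset_union_right
    obtain ⟨h1, h2⟩ := ih (fun i => t i.castSucc) (ht.comp (Fin.castSucc_injective k))
      (fun i => htc _) hM' fun i => m i.castSucc
    have hk := ket_mem_supportedOn (M := M) (𝕜 := 𝕜) (t (Fin.last k)) (m (Fin.last k))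
    have hd : Disjoint (support c ∪ Finset.univ.image fun i : Fin k => t i.castSucc)
        {t (Fin.last k)} := by
      rw [Finset.disjoint_singleton_right, Finset.mem_union, Finset.mem_image]
      rintro (h | ⟨i, -, h⟩)
      · exact htc _ h
      · exact (Fin.castSucc_lt_last i).ne (ht h)
    rw [eigenvector_succ]
    refine ⟨starHom_mem_supportedOn hM' hx h1 hk, ?_⟩
    rw [localLaplacian_starHom hd hM h1 hk, h2, localLaplacian_ket hx, map_smul, map_smul,
      LinearMap.smul_apply, ← add_smul, Fin.sum_univ_castSucc]
    congr 1
    ring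

theorem span_ket (x : V) (hp : p ≠ 0) :
    Submodule.span 𝕜 (Set.range fun m : Fin p => ket M 𝕜 p x m) =
      Submodule.span 𝕜 (Set.range fun j : Fin p => vec M 𝕜 {toLex (j, x)}) := by
  have hsq : ∀ i : ℕ, (-1 : 𝕜) ^ i * (-1) ^ i = 1 := fun i => by rw [← mul_pow]; simp
  have hpt : ∀ j (hj : j < p), point M 𝕜 p x j ∈
      Submodule.span 𝕜 (Set.range fun j : Fin p => vec M 𝕜 {toLex (j, x)}) := fun j hj => by
    rw [point_eq_vec ⟨j, hj⟩]
    exact Submodule.subset_span ⟨⟨j, hj⟩, rfl⟩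
  apply le_antisymm
  · refine Submodule.span_le.2 ?_
    rintro _ ⟨m, rfl⟩
    change ket M 𝕜 p x m ∈ Submodule.span 𝕜 _
    unfold ket
    split_ifs
    · exact Submodule.sum_mem _ fun j hj =>
        Submodule.smul_mem _ _ (hpt _ (Finset.mem_range.1 hj))
    · exact Submodule.sub_mem _ (Submodule.smul_mem _ _ (hpt _ (by omega)))
        (Submodule.smul_mem _ _ (hpt _ m.2))
  · set W := Submodule.span 𝕜 (Set.range fun m : Fin p => ket M 𝕜 p x m)
    have hW : ∀ m (hm : m < p), ket M 𝕜 p x m ∈ W := fun m hm =>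
      Submodule.subset_span ⟨⟨m, hm⟩, rfl⟩
    -- modulo `W`, all the vectors `(-1)^j • x_j` agree with the one for `j = 0`
    have hdiff : ∀ j, j < p → point M 𝕜 p x 0 - (-1 : 𝕜) ^ j • point M 𝕜 p x j ∈ W := by
      intro j
      induction j with
      | zero => intro _; simp
      | succ j ih =>
        intro hj
        have h := Submodule.add_mem _ (ih (by omega)) (hW (j + 1) hj)
        rw [ket, if_neg (Nat.succ_ne_zero j), Nat.add_sub_cancel] at h
        simpa using h
    -- and their sum lies in `W`
    have h0 : point M 𝕜 p x 0 ∈ W := by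
      have h := Submodule.add_mem _ (Submodule.sum_mem W fun j hj =>
        hdiff j (Finset.mem_range.1 hj)) (hW 0 (by omega))
      rw [Finset.sum_sub_distrib, ket, if_pos rfl, sub_add_cancel, Finset.sum_const,
        Finset.card_range, ← Nat.cast_smul_eq_nsmul 𝕜] at h
      exact (Submodule.smul_mem_iff _ (Nat.cast_ne_zero.2 hp)).1 h
    refine Submodule.span_le.2 ?_
    rintro _ ⟨j, rfl⟩
    have h := Submodule.smul_mem W ((-1 : 𝕜) ^ (j : ℕ))
      (Submodule.sub_mem _ h0 (hdiff j j.2))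
    rw [sub_sub_cancel, smul_smul, hsq, one_smul, point_eq_vec] at h
    exact h

/-- The set of sites of the tuple `c` with each vertex `t i` added at the place `f i`. -/
def attach {k : ℕ} (c : Fin p → M.Simplex) (t : Fin k → V) (f : Fin k → Fin p) :
    Finset (Fin p ×ₗ V) :=
  sites c ∪ Finset.univ.image fun i => toLex (f i, t i)

theorem vert_attach {k : ℕ} (c : Fin p → M.Simplex) (t : Fin k → V) (f : Fin k → Fin p) :
    vert (attach c t f) = support c ∪ Finset.univ.image t := by
  rw [attach, vert_union, vert_sites, vert, Finset.image_image]
  rfl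

theorem attach_succ {k : ℕ} (c : Fin p → M.Simplex) (t : Fin (k + 1) → V)
    (f : Fin (k + 1) → Fin p) :
    attach c t f = attach c (fun i => t i.castSucc) (fun i => f i.castSucc) ∪
      {toLex (f (Fin.last k), t (Fin.last k))} := by
  have h := fun a : Fin p ×ₗ V => Fin.exists_fin_succ' (P := fun i => toLex (f i, t i) = a)
  ext a
  simp only [attach, Finset.mem_union, Finset.mem_image, Finset.mem_univ, true_and, h,
    Finset.mem_singleton, or_assoc, eq_comm (a := a)]

/-- By bilinearity, kets may be replaced by points in the products, and a product of points with `c`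
is a tuple up to a sign. -/
theorem span_eigenvector (hp : p ≠ 0) {c : Fin p → M.Simplex}
    {k : ℕ} (t : Fin k → V) (hM : support c ∪ Finset.univ.image t ∈ M.faces) :
    Submodule.span 𝕜 (Set.range fun m : Fin k → Fin p => eigenvector 𝕜 c t m) =
      Submodule.span 𝕜 (Set.range fun f : Fin k → Fin p => vec M 𝕜 (attach c t f)) := by
  induction k with
  | zero =>
    congr 2
    funext m
    rw [eigenvector, Fin.foldl_zero, attach]
    simp [vec_sites]
  | succ k ih =>
    rw [image_univ_castSucc, ← Finset.union_assoc] at hM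
    have hM' := M.down_closed _ hM _ Finset.subset_union_left
    have hx : {t (Fin.last k)} ∈ M.faces := M.down_closed _ hM _ Finset.subset_union_right
    have hL : (Set.range fun m : Fin (k + 1) → Fin p => eigenvector 𝕜 c t m) =
        Set.image2 (fun u v => starHom M 𝕜 p u v)
          (Set.range fun m : Fin k → Fin p => eigenvector 𝕜 c (fun i => t i.castSucc) m)
          (Set.range fun m : Fin p => ket M 𝕜 p (t (Fin.last k)) m) := by
      ext v
      simp only [Set.mem_range, Set.mem_image2, exists_exists_eq_and]
      constructor
      · rintro ⟨m, rfl⟩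
        exact ⟨_, _, (eigenvector_succ 𝕜 c t m).symm⟩
      · rintro ⟨m, m', rfl⟩
        refine ⟨Fin.snoc m m', ?_⟩
        rw [eigenvector_succ]
        simp
    rw [hL, ← Submodule.map₂_span_span, ih _ hM', span_ket _ hp, Submodule.map₂_span_span]
    have hv : ∀ f : Fin (k + 1) → Fin p,
        starHom M 𝕜 p (vec M 𝕜 (attach c (fun i => t i.castSucc) (fun i => f i.castSucc)))
          (vec M 𝕜 {toLex (f (Fin.last k), t (Fin.last k))}) =
        (-1 : 𝕜) ^ inversions (attach c (fun i => t i.castSucc) (fun i => f i.castSucc))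
          {toLex (f (Fin.last k), t (Fin.last k))} • vec M 𝕜 (attach c t f) := by
      intro f
      rw [starHom_vec (by rwa [vert_attach]) (by rwa [vert_singleton]), attach_succ]
    apply le_antisymm
    · refine Submodule.span_le.2 ?_
      rintro _ ⟨_, ⟨f, rfl⟩, _, ⟨j, rfl⟩, rfl⟩
      have h := hv (Fin.snoc f j)
      simp only [Fin.snoc_castSucc, Fin.snoc_last] at h
      simp only [h]
      exact Submodule.smul_mem _ _ (Submodule.subset_span ⟨_, rfl⟩)
    · refine Submodule.span_le.2 ?_
      rintro _ ⟨f, rfl⟩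
      have h0 : (-1 : 𝕜) ^ inversions (attach c (fun i => t i.castSucc) (fun i => f i.castSucc))
          {toLex (f (Fin.last k), t (Fin.last k))} ≠ 0 := pow_ne_zero _ (by simp)
      refine (Submodule.smul_mem_iff _ h0).1 ?_
      rw [← hv]
      exact Submodule.subset_span ⟨_, ⟨_, rfl⟩, _, ⟨_, rfl⟩, rfl⟩

end Eigenvectors

/-! ### Diagonalization and counting -/

section Diagonalization

/-- A finite basis of eigenvectors diagonalizes `T` on its span; the multiplicities are the numbers
of basis vectors with given eigenvalue. -/
theorem isDiagonalizableOn_of_eigenbasis {𝕜 E ι κ : Type*} [RCLike 𝕜] [AddCommGroup E]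
    [Module 𝕜 E] [Finite ι] [DecidableEq κ] {T : E →ₗ[𝕜] E} {W : Submodule 𝕜 E} {lam : κ → 𝕜}
    (hlam : Function.Injective lam) {b : ι → E} (hb : LinearIndependent 𝕜 b)
    (hW : Submodule.span 𝕜 (Set.range b) = W) (g : ι → κ)
    (hT : ∀ i, T (b i) = lam (g i) • b i) :
    IsDiagonalizableOn T W lam fun k => Nat.card {i // g i = k} := by
  subst hW
  have hinv : ∀ v ∈ Submodule.span 𝕜 (Set.range b), T v ∈ Submodule.span 𝕜 (Set.range b) := by
    intro v hv
    have h : Submodule.span 𝕜 (Set.range b) ≤ (Submodule.span 𝕜 (Set.range b)).comap T := by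
      refine Submodule.span_le.2 ?_
      rintro _ ⟨i, rfl⟩
      change T (b i) ∈ Submodule.span 𝕜 (Set.range b)
      rw [hT]
      exact Submodule.smul_mem _ _ (Submodule.subset_span ⟨i, rfl⟩)
    exact h hv
  let B := Module.Basis.span hb
  have hB : ∀ i, T.restrict hinv (B i) = lam (g i) • B i := by
    intro i
    apply Subtype.ext
    rw [LinearMap.coe_restrict_apply, Submodule.coe_smul, Module.Basis.span_apply, hT]
  have hmem : ∀ i, B i ∈ Module.End.eigenspace (T.restrict hinv) (lam (g i)) := fun i =>
    Module.End.mem_eigenspace_iff.2 (hB i)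
  have hcoord : ∀ i v, B.repr (T.restrict hinv v) i = lam (g i) * B.repr v i := by
    intro i v
    have : B.coord i ∘ₗ T.restrict hinv = lam (g i) • B.coord i := by
      refine B.ext fun j => ?_
      rw [LinearMap.comp_apply, hB, map_smul, LinearMap.smul_apply, Module.Basis.coord_apply,
        Module.Basis.repr_self, smul_eq_mul, smul_eq_mul]
      rcases eq_or_ne j i with rfl | hji
      · rfl
      · rw [Finsupp.single_eq_of_ne' hji, mul_zero, mul_zero]
    exact LinearMap.congr_fun this v
  have heig : ∀ k, Module.End.eigenspace (T.restrict hinv) (lam k) =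
      Submodule.span 𝕜 (B '' {i | g i = k}) := by
    intro k
    apply le_antisymm
    · intro v hv
      rw [Module.End.mem_eigenspace_iff] at hv
      rw [Module.Basis.mem_span_image]
      intro i hi
      have h := hcoord i v
      rw [hv, map_smul, Finsupp.smul_apply, smul_eq_mul] at h
      exact (hlam (mul_right_cancel₀ (Finsupp.mem_support_iff.1 hi) h)).symm
    · refine Submodule.span_le.2 ?_
      rintro _ ⟨i, rfl, rfl⟩
      exact hmem i
  refine ⟨hinv, DirectSum.isInternal_submodule_of_iSupIndep_of_iSup_eq_top
    ((Module.End.eigenspaces_iSupIndep _).comp hlam) ?_, fun k => ?_⟩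
  · rw [eq_top_iff, ← B.span_eq]
    refine Submodule.span_le.2 ?_
    rintro _ ⟨i, rfl⟩
    exact Submodule.mem_iSup_of_mem (g i) (hmem i)
  · have : Fintype {i // g i = k} := Fintype.ofFinite _
    change _ = Nat.card {i // g i = k}
    rw [heig, Set.image_eq_range, Nat.card_eq_fintype_card]
    exact finrank_span_eq_card (b := fun i : {i // g i = k} => B i)
      (B.linearIndependent.comp _ Subtype.val_injective)

theorem card_fun_zeros (p k i : ℕ) (hp : 1 ≤ p) :
    Nat.card {m : Fin k → Fin p // (Finset.univ.filter fun j => (m j : ℕ) = 0).card = i} =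
      k.choose i * (p - 1) ^ (k - i) := by
  classical
  rw [Nat.card_eq_fintype_card, Fintype.card_subtype,
    Finset.card_eq_sum_card_fiberwise (t := Finset.powersetCard i Finset.univ)
      (f := fun m : Fin k → Fin p => Finset.univ.filter fun j => (m j : ℕ) = 0)]
  · have h0 : (Finset.univ.filter fun a : Fin p => (a : ℕ) = 0).card = 1 := by
      rw [Finset.card_eq_one]
      exact ⟨⟨0, hp⟩, by ext a; simp [Fin.ext_iff]⟩
    have h1 : (Finset.univ.filter fun a : Fin p => (a : ℕ) ≠ 0).card = p - 1 := by
      have := Finset.card_filter_add_card_filter_not (s := Finset.univ)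
        (fun a : Fin p => (a : ℕ) = 0)
      rw [h0, Finset.card_univ, Fintype.card_fin] at this
      simp only [ne_eq]
      omega
    rw [Finset.sum_congr rfl (g := fun _ => (p - 1) ^ (k - i)), Finset.sum_const,
      Finset.card_powersetCard, Finset.card_univ, Fintype.card_fin, smul_eq_mul]
    intro A hA
    have hAc : A.card = i := (Finset.mem_powersetCard.1 hA).2
    have : (Finset.univ.filter fun m : Fin k → Fin p =>
          (Finset.univ.filter fun j => (m j : ℕ) = 0).card = i).filter
          (fun m => (Finset.univ.filter fun j => (m j : ℕ) = 0) = A) =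
        Fintype.piFinset fun j => if j ∈ A then Finset.univ.filter fun a : Fin p => (a : ℕ) = 0
          else Finset.univ.filter fun a : Fin p => (a : ℕ) ≠ 0 := by
      ext m
      simp only [Finset.mem_filter, Finset.mem_univ, true_and, Fintype.mem_piFinset]
      constructor
      · rintro ⟨-, rfl⟩ j
        split_ifs with h <;> simpa using h
      · intro h
        have hm : (Finset.univ.filter fun j => (m j : ℕ) = 0) = A := by
          ext j
          have := h j
          split_ifs at this with hj <;> simp_all
        exact ⟨by rw [hm, hAc], hm⟩
    rw [this, Fintype.card_piFinset]
    simp only [apply_ite Finset.card, h0, h1]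
    rw [Finset.prod_ite, Finset.prod_const_one, one_mul, Finset.prod_const,
      Finset.filter_not, Finset.filter_mem_eq_inter, Finset.univ_inter,
      Finset.card_univ_sdiff, Fintype.card_fin, hAc]
  · intro m hm
    exact Finset.mem_powersetCard.2 ⟨Finset.subset_univ _, (Finset.mem_filter.1 hm).2⟩

theorem card_finset_two_le (p : ℕ) :
    Nat.card {A : Finset (Fin p) // 2 ≤ A.card} = 2 ^ p - p - 1 := by
  have h0 := Fintype.card_finset_len (α := Fin p) 0
  have h1 := Fintype.card_finset_len (α := Fin p) 1
  rw [Fintype.card_subtype, Fintype.card_fin] at h0 h1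
  rw [Nat.choose_zero_right] at h0
  rw [Nat.choose_one_right] at h1
  rw [Nat.card_eq_fintype_card, Fintype.card_subtype]
  have h := Finset.card_filter_add_card_filter_not (s := Finset.univ)
    (fun A : Finset (Fin p) => 2 ≤ A.card)
  have h2 : (Finset.univ.filter fun A : Finset (Fin p) => ¬ 2 ≤ A.card) =
      (Finset.univ.filter fun A : Finset (Fin p) => A.card = 0) ∪
        Finset.univ.filter fun A : Finset (Fin p) => A.card = 1 := by
    ext A
    simp only [Finset.mem_filter, Finset.mem_univ, true_and, Finset.mem_union]
    omega
  rw [h2, Finset.card_union_of_disjoint, h0, h1, Finset.card_univ, Fintype.card_finset,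
    Fintype.card_fin] at h
  · omega
  · exact Finset.disjoint_filter.2 fun A _ h => by omega

end Diagonalization

/-! ### Placements and the tuples over them -/

section Placements

variable {V : Type*} [LinearOrder V] {M : DiscreteComplex V} {𝕜 : Type*} [RCLike 𝕜] {p k : ℕ}
variable {σ τ ρ : Finset V} {c : Fin p → M.Simplex}

theorem IsPlacement.support_eq (hc : IsPlacement c ρ) : support c = ρ := by
  apply le_antisymm
  · exact Finset.biUnion_subset.2 fun i _ => hc.1 i
  · intro x hx
    have h := hc.2 x hx
    obtain ⟨i, hi⟩ := Finset.card_pos.1 (lt_of_lt_of_le zero_lt_two h)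
    exact Finset.mem_biUnion.2 ⟨i, Finset.mem_univ _, (Finset.mem_filter.1 hi).2⟩

theorem IsPlacement.freeSites_eq_empty (hc : IsPlacement c ρ) : freeSites (sites c) = ∅ := by
  refine Finset.filter_eq_empty_iff.2 fun a ha => not_not.2 ?_
  have hx : (ofLex a).2 ∈ ρ := hc.1 _ (mem_sites.1 ha)
  obtain ⟨i, hi, hia⟩ := Finset.exists_mem_ne (hc.2 _ hx) (ofLex a).1
  refine mem_vert.2 ⟨toLex (i, (ofLex a).2), Finset.mem_erase.2 ⟨fun h => hia ?_, ?_⟩, rfl⟩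
  · rw [← h]
    rfl
  · exact mem_sites.2 (Finset.mem_filter.1 hi).2

/-- A placement chooses, for every vertex of `ρ` independently, the set of at least two places where
the vertex lies. -/
theorem card_placements (hρ : ρ ∈ M.faces) :
    Nat.card {c : Fin p → M.Simplex // IsPlacement c ρ} = (2 ^ p - p - 1) ^ ρ.card := by
  have hbij : Function.Bijective
      (fun (c : {c : Fin p → M.Simplex // IsPlacement c ρ}) (x : ρ) =>
        (⟨Finset.univ.filter fun i => x.1 ∈ (c.1 i).1, c.2.2 x x.2⟩ :
          {A : Finset (Fin p) // 2 ≤ A.card})) := by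
    constructor
    · intro c c' h
      apply Subtype.ext
      funext i
      apply Subtype.ext
      ext x
      by_cases hx : x ∈ ρ
      · have h' := congrArg Subtype.val (congrFun h ⟨x, hx⟩)
        have h'' := Finset.ext_iff.1 h' i
        simpa using h''
      · exact ⟨fun h => absurd (c.2.1 i h) hx, fun h => absurd (c'.2.1 i h) hx⟩
    · intro F
      have hsub : ∀ i, (ρ.attach.filter fun x => i ∈ (F x).1).image Subtype.val ⊆ ρ := by
        intro i y hy
        obtain ⟨x, _, rfl⟩ := Finset.mem_image.1 hy
        exact x.2
      have hmem : ∀ (i : Fin p) (x : ρ),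
          x.1 ∈ (ρ.attach.filter fun x => i ∈ (F x).1).image Subtype.val ↔ i ∈ (F x).1 := by
        intro i x
        simp
      refine ⟨⟨fun i => ⟨_, M.down_closed _ hρ _ (hsub i)⟩, hsub, fun x hx => ?_⟩, ?_⟩
      · simp only [hmem _ ⟨x, hx⟩, Finset.filter_mem_eq_inter, Finset.univ_inter]
        exact (F ⟨x, hx⟩).2
      · funext x
        apply Subtype.ext
        simp only [hmem, Finset.filter_mem_eq_inter, Finset.univ_inter]
  rw [Nat.card_eq_of_bijective _ hbij, Nat.card_fun, card_finset_two_le, Nat.card_eq_fintype_card,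
    Fintype.card_coe]

theorem mem_attach {t : Fin k → V} {f : Fin k → Fin p} {i : Fin p} {x : V} :
    toLex (i, x) ∈ attach c t f ↔ x ∈ (c i).1 ∨ ∃ j, f j = i ∧ t j = x := by
  simp [attach, mem_sites]

/-- The tuples that span `Ω_*^{⊗p}(σ, τ; c)` are those which add the vertices of `τ` to `c`, each at
exactly one place. -/
theorem sites_eq_attach_iff (hσM : σ ∈ M.faces) (hσ : σ.Nonempty) (hτ : τ ⊆ σ)
    (hc : IsPlacement c (σ \ τ)) {t : Fin k → V} (ht : Function.Injective t)
    (htτ : Finset.univ.image t = τ) (e : Fin p → M.Simplex) :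
    (envelope e = σ ∧ freeVertices e = τ ∧ ∀ i, (e i).1 \ τ = (c i).1) ↔
      ∃ f, sites e = attach c t f := by
  have htm : ∀ j, t j ∈ τ := fun j => htτ ▸ Finset.mem_image_of_mem t (Finset.mem_univ j)
  have hcτ : ∀ i, ∀ x ∈ (c i).1, x ∉ τ := fun i x hx => (Finset.mem_sdiff.1 (hc.1 i hx)).2
  constructor
  · rintro ⟨hσe, hτe, hec⟩
    have h1 : ∀ j, ∃ i, (Finset.univ.filter fun i => t j ∈ (e i).1) = {i} := by
      intro j
      have := htm j
      rw [← hτe] at this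
      exact Finset.card_eq_one.1 (Finset.mem_filter.1 this).2
    choose f hf using h1
    have hf' : ∀ i j, t j ∈ (e i).1 ↔ f j = i := by
      intro i j
      have := Finset.ext_iff.1 (hf j) i
      simpa [eq_comm] using this
    refine ⟨f, ?_⟩
    ext a
    obtain ⟨i, x⟩ := a
    change toLex (i, x) ∈ sites e ↔ toLex (i, x) ∈ attach c t f
    rw [mem_attach, mem_sites]
    change x ∈ (e i).1 ↔ _
    by_cases hx : x ∈ τ
    · rw [← htτ] at hx
      obtain ⟨j, -, rfl⟩ := Finset.mem_image.1 hx
      rw [hf']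
      constructor
      · intro h
        exact .inr ⟨j, h, rfl⟩
      · rintro (h | ⟨j', h, h'⟩)
        · exact absurd (htm j) (hcτ i _ h)
        · rwa [← ht h']
    · rw [← hec, Finset.mem_sdiff]
      constructor
      · intro h
        exact .inl ⟨h, hx⟩
      · rintro (h | ⟨j, -, rfl⟩)
        · exact h.1
        · exact absurd (htm j) hx
  · rintro ⟨f, hf⟩
    have hmem : ∀ i x, x ∈ (e i).1 ↔ x ∈ (c i).1 ∨ ∃ j, f j = i ∧ t j = x := by
      intro i x
      rw [← mem_attach, ← hf, mem_sites]
      rfl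
    have henv : envelope e = σ := by
      rw [envelope_eq_iff_of_nonempty hσ hσM, hf, vert_attach, hc.support_eq, htτ,
        Finset.sdiff_union_of_subset hτ]
    refine ⟨henv, ?_, ?_⟩
    · ext x
      rw [freeVertices, henv, Finset.mem_filter]
      by_cases hx : x ∈ τ
      · refine iff_of_true ⟨hτ hx, ?_⟩ hx
        rw [← htτ] at hx
        obtain ⟨j, -, rfl⟩ := Finset.mem_image.1 hx
        refine Finset.card_eq_one.2 ⟨f j, ?_⟩
        ext i
        rw [Finset.mem_filter, Finset.mem_singleton, hmem]
        constructor
        · rintro ⟨-, h | ⟨j', h, h'⟩⟩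
          · exact absurd (htm j) (hcτ i _ h)
          · rw [← ht h', h]
        · rintro rfl
          exact ⟨Finset.mem_univ _, .inr ⟨j, rfl, rfl⟩⟩
      · refine iff_of_false ?_ hx
        rintro ⟨hxσ, hcard⟩
        have h2 := hc.2 x (Finset.mem_sdiff.2 ⟨hxσ, hx⟩)
        have : (Finset.univ.filter fun i => x ∈ (e i).1) =
            Finset.univ.filter fun i => x ∈ (c i).1 := by
          refine Finset.filter_congr fun i _ => ?_
          rw [hmem, or_iff_left]
          rintro ⟨j, -, rfl⟩
          exact hx (htm j)
        rw [← this, hcard] at h2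
        omega
    · intro i
      ext x
      rw [Finset.mem_sdiff, hmem]
      constructor
      · rintro ⟨h | ⟨j, -, rfl⟩, h'⟩
        · exact h
        · exact absurd (htm j) h'
      · intro h
        exact ⟨.inl h, hcτ i x h⟩

/-- The non-free vertices of a tuple form a placement: a vertex of the envelope lies in at least one
of the simplexes, and in exactly one only if it is free. -/
theorem isPlacement_sdiff {e : Fin p → M.Simplex} (hσM : σ ∈ M.faces) (hσ : σ.Nonempty)
    (h1 : envelope e = σ) (h2 : freeVertices e = τ) :
    IsPlacement (fun i => (⟨(e i).1 \ τ, M.down_closed _ (e i).2 _ Finset.sdiff_subset⟩ :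
      M.Simplex)) (σ \ τ) := by
  have hs : support e = σ := by
    rw [← vert_sites]
    exact (envelope_eq_iff_of_nonempty hσ hσM).1 h1
  constructor
  · intro i
    refine Finset.sdiff_subset_sdiff ?_ le_rfl
    rw [← hs]
    exact Finset.subset_biUnion_of_mem (fun i => (e i).1) (Finset.mem_univ i)
  · intro x hx
    obtain ⟨hxσ, hxτ⟩ := Finset.mem_sdiff.1 hx
    simp only [Finset.mem_sdiff, hxτ, not_false_eq_true, and_true]
    have hne : (Finset.univ.filter fun i => x ∈ (e i).1).card ≠ 1 := by
      intro h
      apply hxτ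
      rw [← h2, freeVertices, h1]
      exact Finset.mem_filter.2 ⟨hxσ, h⟩
    have hpos : 0 < (Finset.univ.filter fun i => x ∈ (e i).1).card := by
      rw [← hs] at hxσ
      obtain ⟨i, _, hi⟩ := Finset.mem_biUnion.1 hxσ
      exact Finset.card_pos.2 ⟨i, Finset.mem_filter.2 ⟨Finset.mem_univ _, hi⟩⟩
    omega

theorem attach_injective (hc : IsPlacement c (σ \ τ)) {c' : Fin p → M.Simplex}
    (hc' : IsPlacement c' (σ \ τ)) {t : Fin k → V} (ht : Function.Injective t)
    (htτ : Finset.univ.image t = τ) {f f' : Fin k → Fin p} (h : attach c t f = attach c' t f') :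
    c = c' ∧ f = f' := by
  have htm : ∀ j, t j ∈ τ := fun j => htτ ▸ Finset.mem_image_of_mem t (Finset.mem_univ j)
  have hmem : ∀ i x, (x ∈ (c i).1 ∨ ∃ j, f j = i ∧ t j = x) ↔
      (x ∈ (c' i).1 ∨ ∃ j, f' j = i ∧ t j = x) := fun i x => by
    rw [← mem_attach, h, mem_attach]
  constructor
  · funext i
    apply Subtype.ext
    ext x
    by_cases hx : x ∈ τ
    · exact iff_of_false (fun h => (Finset.mem_sdiff.1 (hc.1 i h)).2 hx)
        (fun h => (Finset.mem_sdiff.1 (hc'.1 i h)).2 hx)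
    · have hn : ∀ f : Fin k → Fin p, ¬ ∃ j, f j = i ∧ t j = x := by
        rintro f ⟨j, -, rfl⟩
        exact hx (htm j)
      simpa [hn] using hmem i x
  · funext j
    rcases (hmem (f j) (t j)).1 (.inr ⟨j, rfl, rfl⟩) with h | ⟨j', h, h'⟩
    · exact absurd (htm j) (Finset.mem_sdiff.1 (hc'.1 _ h)).2
    · rw [← h, ht h']

theorem linearIndependent_vec {ι : Type*} {S : ι → Finset (Fin p ×ₗ V)}
    (hS : Function.Injective S) (hM : ∀ i, vert (S i) ∈ M.faces) :
    LinearIndependent 𝕜 fun i => vec M 𝕜 (S i) := by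
  choose e he using fun i => exists_sites_eq (hM i)
  have hinj : Function.Injective e := fun i j h => hS (by rw [← he, ← he, h])
  have := (Finsupp.linearIndependent_single_one 𝕜 (Fin p → M.Simplex)).comp e hinj
  convert this using 2 with i
  rw [Function.comp_apply, ← he, vec_sites]

theorem placedSubspace_eq_span (hσM : σ ∈ M.faces) (hσ : σ.Nonempty) (hτ : τ ⊆ σ)
    (hc : IsPlacement c (σ \ τ)) {t : Fin k → V} (ht : Function.Injective t)
    (htτ : Finset.univ.image t = τ) :
    placedSubspace 𝕜 σ τ c =
      Submodule.span 𝕜 (Set.range fun f : Fin k → Fin p => vec M 𝕜 (attach c t f)) := by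
  have hiff := sites_eq_attach_iff hσM hσ hτ hc ht htτ
  rw [placedSubspace]
  congr 1
  ext v
  constructor
  · rintro ⟨e, h1, h2, h3, rfl⟩
    obtain ⟨f, hf⟩ := (hiff e).1 ⟨h1, h2, h3⟩
    exact ⟨f, by rw [← vec_sites, hf]⟩
  · rintro ⟨f, rfl⟩
    obtain ⟨e, he⟩ := exists_sites_eq (M := M) (S := attach c t f) (by
      rwa [vert_attach, hc.support_eq, htτ, Finset.sdiff_union_of_subset hτ])
    obtain ⟨h1, h2, h3⟩ := (hiff e).2 ⟨f, he⟩
    exact ⟨e, h1, h2, h3, by rw [← vec_sites, he]⟩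

theorem freeSubspace_eq_iSup (hσM : σ ∈ M.faces) (hσ : σ.Nonempty) :
    freeSubspace M 𝕜 p σ τ =
      ⨆ c : {c : Fin p → M.Simplex // IsPlacement c (σ \ τ)}, placedSubspace 𝕜 σ τ c.1 := by
  apply le_antisymm
  · refine Submodule.span_le.2 ?_
    rintro _ ⟨e, h1, h2, rfl⟩
    exact Submodule.mem_iSup_of_mem ⟨_, isPlacement_sdiff hσM hσ h1 h2⟩
      (Submodule.subset_span ⟨e, h1, h2, fun _ => rfl, rfl⟩)
  · refine iSup_le fun c => Submodule.span_mono ?_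
    rintro _ ⟨e, h1, h2, -, rfl⟩
    exact ⟨e, h1, h2, rfl⟩

end Placements

/-! ### Self-adjointness -/

section Adjoint

variable {V : Type*} [LinearOrder V] {M : DiscreteComplex V} {𝕜 : Type*} [RCLike 𝕜] {p : ℕ}

/-- The matrices of `A` and `B` in the standard basis are conjugate transposes of each other. -/
def IsConjTranspose {E : Type*} (A B : (E →₀ 𝕜) →ₗ[𝕜] (E →₀ 𝕜)) : Prop :=
  ∀ e f, starRingEnd 𝕜 (A (Finsupp.single e 1) f) = B (Finsupp.single f 1) e

theorem IsConjTranspose.symm {E : Type*} {A B : (E →₀ 𝕜) →ₗ[𝕜] (E →₀ 𝕜)}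
    (h : IsConjTranspose A B) : IsConjTranspose B A := fun e f => by
  rw [← h f e, starRingEnd_self_apply]

theorem IsConjTranspose.sum_conj_mul {E : Type*} [Fintype E] {A B : (E →₀ 𝕜) →ₗ[𝕜] (E →₀ 𝕜)}
    (h : IsConjTranspose A B) (u v : E →₀ 𝕜) :
    ∑ e, starRingEnd 𝕜 (A u e) * v e = ∑ e, starRingEnd 𝕜 (u e) * B v e := by
  have hcoord : ∀ (C : (E →₀ 𝕜) →ₗ[𝕜] (E →₀ 𝕜)) (w : E →₀ 𝕜) (f : E),
      C w f = ∑ e, w e * C (Finsupp.single e 1) f := by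
    intro C w f
    conv_lhs => rw [← Finsupp.univ_sum_single w]
    rw [map_sum, Finsupp.finsetSum_apply]
    refine Finset.sum_congr rfl fun e _ => ?_
    rw [← Finsupp.smul_single_one, map_smul, Finsupp.smul_apply, smul_eq_mul]
  simp only [hcoord A u, hcoord B v, map_sum, map_mul, Finset.sum_mul, Finset.mul_sum, ← h _ _]
  rw [Finset.sum_comm]
  refine Finset.sum_congr rfl fun e _ => Finset.sum_congr rfl fun f _ => ?_
  ring

theorem formVec_apply (s : Finset V) (t : M.Simplex) :
    formVec M 𝕜 s t = if s = t.1 then 1 else 0 := by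
  unfold formVec
  split_ifs with h h' h'
  · subst h'
    exact Finsupp.single_eq_same
  · exact Finsupp.single_eq_of_ne' fun h'' => h' (congrArg Subtype.val h'')
  · exact absurd (h' ▸ t.2) h
  · rfl

theorem isConjTranspose_d_del : IsConjTranspose (d M 𝕜) (del M 𝕜) := by
  intro s t
  rw [d, del, Finsupp.linearCombination_single, Finsupp.linearCombination_single, one_smul,
    one_smul, Finsupp.finsetSum_apply, Finsupp.finsetSum_apply]
  simp only [Finsupp.smul_apply, formVec_apply, smul_eq_mul, mul_ite, mul_one, mul_zero]
  rw [← Finset.sum_filter, ← Finset.sum_filter, map_sum]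
  have hset : (M.vertices \ s.1).filter (fun x => insert x s.1 = t.1) =
      t.1.filter fun x => t.1.erase x = s.1 := by
    ext x
    simp only [Finset.mem_filter, Finset.mem_sdiff]
    constructor
    · rintro ⟨⟨-, hx⟩, h⟩
      rw [← h]
      exact ⟨Finset.mem_insert_self _ _, Finset.erase_insert hx⟩
    · rintro ⟨hx, h⟩
      rw [← h]
      exact ⟨⟨Finset.mem_biUnion.2 ⟨_, t.2, hx⟩, Finset.notMem_erase _ _⟩, Finset.insert_erase hx⟩
  rw [← hset]
  refine Finset.sum_congr rfl fun x hx => ?_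
  rw [(Finset.mem_filter.1 hx).2, beta, map_pow, map_neg, map_one]

theorem mapDomain_update_apply (e f : Fin p → M.Simplex) (j : Fin p) (w : M.Forms 𝕜) :
    Finsupp.mapDomain (fun s : M.Simplex => Function.update e j s) w f =
      if ∀ i, i ≠ j → e i = f i then w (f j) else 0 := by
  have hinj : Function.Injective fun s : M.Simplex => Function.update e j s :=
    Function.update_injective e j
  split_ifs with h
  · have hf : f = (fun s : M.Simplex => Function.update e j s) (f j) := by
      funext i
      rcases eq_or_ne i j with rfl | hij
      · simp
      · simp [hij, h i hij]
    conv_lhs => rw [hf]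
    exact Finsupp.mapDomain_apply hinj w (f j)
  · refine Finsupp.mapDomain_of_notMem_range _ _ ?_
    rintro ⟨s, rfl⟩
    exact h fun i hij => (Function.update_of_ne hij _ _).symm

theorem IsConjTranspose.lift {A B : M.Forms 𝕜 →ₗ[𝕜] M.Forms 𝕜} (h : IsConjTranspose A B) :
    IsConjTranspose (lift p A) (lift p B) := by
  intro e f
  rw [DiscreteComplex.lift, DiscreteComplex.lift, Finsupp.linearCombination_single,
    Finsupp.linearCombination_single, one_smul, one_smul, Finsupp.finsetSum_apply,
    Finsupp.finsetSum_apply, map_sum]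
  refine Finset.sum_congr rfl fun j _ => ?_
  rw [Finsupp.smul_apply, Finsupp.smul_apply, mapDomain_update_apply, mapDomain_update_apply,
    smul_eq_mul, smul_eq_mul, map_mul, map_zpow₀, map_neg, map_one]
  by_cases hef : ∀ i, i ≠ j → e i = f i
  · rw [if_pos hef, if_pos fun i hi => (hef i hi).symm, h]
    congr 3
    refine Finset.sum_congr rfl fun i hi => ?_
    rw [hef i (Finset.mem_filter.1 hi).2.ne]
  · rw [if_neg hef, if_neg fun h' => hef fun i hi => (h' i hi).symm, map_zero, mul_zero, mul_zero]

theorem IsConjTranspose.localize {A B : M.TensorForms 𝕜 p →ₗ[𝕜] M.TensorForms 𝕜 p}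
    (h : IsConjTranspose A B) : IsConjTranspose (localize A) (localize B) := by
  intro e f
  rw [DiscreteComplex.localize, DiscreteComplex.localize, Finsupp.linearCombination_single,
    Finsupp.linearCombination_single, one_smul, one_smul, Finsupp.filter_apply,
    Finsupp.filter_apply, ← h, eq_comm, apply_ite (starRingEnd 𝕜), map_zero]
  simp only [eq_comm]

theorem localLaplacian_selfAdjoint (u v : M.TensorForms 𝕜 p) :
    ∑ e, starRingEnd 𝕜 (M.localLaplacian 𝕜 p u e) * v e =
      ∑ e, starRingEnd 𝕜 (u e) * M.localLaplacian 𝕜 p v e := by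
  have h : IsConjTranspose (localize (lift p (d M 𝕜))) (localize (lift p (del M 𝕜))) :=
    isConjTranspose_d_del.lift.localize
  simp only [localLaplacian, LinearMap.add_apply, LinearMap.comp_apply, Finsupp.add_apply, map_add,
    add_mul, mul_add, Finset.sum_add_distrib]
  rw [h.sum_conj_mul, h.symm.sum_conj_mul, h.symm.sum_conj_mul, h.sum_conj_mul]

end Adjoint

/-! ### The spectrum -/

section Spectrum

variable {V : Type*} [LinearOrder V] {M : DiscreteComplex V} {𝕜 : Type*} [RCLike 𝕜] {p k : ℕ}
variable {σ τ : Finset V} {c : Fin p → M.Simplex}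

theorem localLaplacian_placed_eigenvector (hσM : σ ∈ M.faces) (hτ : τ ⊆ σ) (hk : k = τ.card)
    (hc : IsPlacement c (σ \ τ)) {t : Fin k → V} (ht : Function.Injective t)
    (htτ : Finset.univ.image t = τ) (m : Fin k → Fin p) :
    M.localLaplacian 𝕜 p (eigenvector 𝕜 c t m) =
      ((p : 𝕜) * ((σ.card : 𝕜) - k + ∑ i, if (m i : ℕ) = 0 then 0 else 1)) •
        eigenvector 𝕜 c t m := by
  have htc : ∀ j, t j ∉ support c := fun j => by
    rw [hc.support_eq]
    have : t j ∈ τ := htτ ▸ Finset.mem_image_of_mem t (Finset.mem_univ j)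
    exact fun h => (Finset.mem_sdiff.1 h).2 this
  have hM : support c ∪ Finset.univ.image t ∈ M.faces := by
    rwa [hc.support_eq, htτ, Finset.sdiff_union_of_subset hτ]
  rw [(localLaplacian_eigenvector hc.freeSites_eq_empty t ht htc hM m).2, hc.support_eq,
    Finset.card_sdiff_of_subset hτ, Nat.cast_sub (Finset.card_le_card hτ), ← hk]

/-- The number of zeros among the entries of `m`: the index `i` of the eigenvalue `λ_i` to which the
vector `|m₁, …, m_k⟩` belongs. -/
def zeros (m : Fin k → Fin p) : Fin (k + 1) :=
  ⟨(Finset.univ.filter fun j => (m j : ℕ) = 0).card,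
    Nat.lt_succ_of_le ((Finset.card_le_univ _).trans_eq (Fintype.card_fin k))⟩

theorem card_zeros_fiber (hp : 1 ≤ p) (i : Fin (k + 1)) :
    Nat.card {m : Fin k → Fin p // zeros m = i} = k.choose i * (p - 1) ^ (k - (i : ℕ)) := by
  rw [← card_fun_zeros p k i hp]
  simp only [zeros, Fin.ext_iff]

theorem eigenvalue_eq (n : ℕ) (m : Fin k → Fin p) :
    (p : 𝕜) * ((n : 𝕜) - k + ∑ i, if (m i : ℕ) = 0 then 0 else 1) =
      ((n : 𝕜) - (zeros m : ℕ)) * p := by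
  have h : ∑ i, (if (m i : ℕ) = 0 then (0 : 𝕜) else 1) + (zeros m : ℕ) = k := by
    change _ + (((Finset.univ.filter fun j => (m j : ℕ) = 0).card : ℕ) : 𝕜) = _
    rw [← Finset.sum_boole, ← Finset.sum_add_distrib, Finset.sum_congr rfl (g := fun _ => (1 : 𝕜))]
    · simp
    · intro i _
      split_ifs <;> simp
  rw [← h]
  ring

theorem eigenvalue_injective (hp : p ≠ 0) (n : ℕ) :
    Function.Injective fun i : Fin (k + 1) => ((n : 𝕜) - (i : ℕ)) * p := by
  intro i j h
  have h' := mul_right_cancel₀ (Nat.cast_ne_zero.2 hp) h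
  exact Fin.ext (Nat.cast_injective (sub_right_injective h'))

theorem vert_attach_mem (hσM : σ ∈ M.faces) (hτ : τ ⊆ σ) (hc : IsPlacement c (σ \ τ))
    {t : Fin k → V} (htτ : Finset.univ.image t = τ) (f : Fin k → Fin p) :
    vert (attach c t f) ∈ M.faces := by
  rwa [vert_attach, hc.support_eq, htτ, Finset.sdiff_union_of_subset hτ]

theorem span_eigenvector_eq_placedSubspace (hp : p ≠ 0) (hσM : σ ∈ M.faces) (hσ : σ.Nonempty)
    (hτ : τ ⊆ σ) (hc : IsPlacement c (σ \ τ)) {t : Fin k → V} (ht : Function.Injective t)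
    (htτ : Finset.univ.image t = τ) :
    Submodule.span 𝕜 (Set.range fun m : Fin k → Fin p => eigenvector 𝕜 c t m) =
      placedSubspace 𝕜 σ τ c := by
  rw [placedSubspace_eq_span hσM hσ hτ hc ht htτ, span_eigenvector hp]
  rwa [hc.support_eq, htτ, Finset.sdiff_union_of_subset hτ]

/-- A finite family that spans the same space as a linearly independent family with the same index
set is linearly independent, by comparison of dimensions. -/
theorem linearIndependent_of_span_eq {E ι : Type*} [AddCommGroup E] [Module 𝕜 E] [Finite ι]
    {b b' : ι → E} (hb' : LinearIndependent 𝕜 b')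
    (h : Submodule.span 𝕜 (Set.range b) = Submodule.span 𝕜 (Set.range b')) :
    LinearIndependent 𝕜 b := by
  have := Fintype.ofFinite ι
  rw [linearIndependent_iff_card_eq_finrank_span, Set.finrank, h, finrank_span_eq_card hb']

theorem span_range_prod {E ι κ : Type*} [AddCommGroup E] [Module 𝕜 E] (b : ι → κ → E) :
    Submodule.span 𝕜 (Set.range fun x : ι × κ => b x.1 x.2) =
      ⨆ i, Submodule.span 𝕜 (Set.range (b i)) := by
  rw [← Submodule.span_iUnion]
  congr 1
  ext v
  simp

theorem span_attach_eq_freeSubspace (hσM : σ ∈ M.faces) (hσ : σ.Nonempty) (hτ : τ ⊆ σ)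
    {t : Fin k → V} (ht : Function.Injective t) (htτ : Finset.univ.image t = τ) :
    Submodule.span 𝕜 (Set.range fun x : {c : Fin p → M.Simplex // IsPlacement c (σ \ τ)} ×
        (Fin k → Fin p) => vec M 𝕜 (attach x.1.1 t x.2)) = freeSubspace M 𝕜 p σ τ := by
  rw [span_range_prod (fun (c : {c : Fin p → M.Simplex // IsPlacement c (σ \ τ)})
    (f : Fin k → Fin p) => vec M 𝕜 (attach c.1 t f)), freeSubspace_eq_iSup hσM hσ]
  exact iSup_congr fun c => (placedSubspace_eq_span hσM hσ hτ c.2 ht htτ).symm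

theorem span_eigenvector_eq_freeSubspace (hp : p ≠ 0) (hσM : σ ∈ M.faces) (hσ : σ.Nonempty)
    (hτ : τ ⊆ σ) {t : Fin k → V} (ht : Function.Injective t) (htτ : Finset.univ.image t = τ) :
    Submodule.span 𝕜 (Set.range fun x : {c : Fin p → M.Simplex // IsPlacement c (σ \ τ)} ×
        (Fin k → Fin p) => eigenvector 𝕜 x.1.1 t x.2) = freeSubspace M 𝕜 p σ τ := by
  rw [span_range_prod (fun (c : {c : Fin p → M.Simplex // IsPlacement c (σ \ τ)})
    (f : Fin k → Fin p) => eigenvector 𝕜 c.1 t f), freeSubspace_eq_iSup hσM hσ]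
  exact iSup_congr fun c => span_eigenvector_eq_placedSubspace hp hσM hσ hτ c.2 ht htτ

theorem linearIndependent_vec_attach (hσM : σ ∈ M.faces) (hτ : τ ⊆ σ)
    {t : Fin k → V} (ht : Function.Injective t) (htτ : Finset.univ.image t = τ) :
    LinearIndependent 𝕜 fun x : {c : Fin p → M.Simplex // IsPlacement c (σ \ τ)} ×
      (Fin k → Fin p) => vec M 𝕜 (attach x.1.1 t x.2) := by
  refine linearIndependent_vec ?_ fun x => vert_attach_mem hσM hτ x.1.2 htτ x.2
  rintro ⟨c, f⟩ ⟨c', f'⟩ h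
  obtain ⟨h1, h2⟩ := attach_injective c.2 c'.2 ht htτ h
  exact Prod.ext (Subtype.ext h1) h2

end Spectrum

end DiscreteComplex

open DiscreteComplex in
theorem mainTheorem4 {V : Type*} [LinearOrder V] {𝕜 : Type*} [RCLike 𝕜]
    (M : DiscreteComplex V) (p : ℕ) (hp : 1 ≤ p)
    (σ τ : Finset V) (hσM : σ ∈ M.faces) (hσ : σ.Nonempty) (hτ : τ ⊆ σ)
    (n k : ℕ) (hn : n = σ.card) (hk : k = τ.card) :
    -- `Δ_loc` is self-adjoint on `Ω(σ, τ)`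
    (∀ u ∈ M.freeSubspace 𝕜 p σ τ, ∀ v ∈ M.freeSubspace 𝕜 p σ τ,
      ∑ e, starRingEnd 𝕜 (M.localLaplacian 𝕜 p u e) * v e =
        ∑ e, starRingEnd 𝕜 (u e) * M.localLaplacian 𝕜 p v e) ∧
    -- eigenvalues and multiplicities on the whole of `Ω(σ, τ)`
    Module.finrank 𝕜 (M.freeSubspace 𝕜 p σ τ) = p ^ k * (2 ^ p - p - 1) ^ (n - k) ∧
    DiscreteComplex.IsDiagonalizableOn (M.localLaplacian 𝕜 p) (M.freeSubspace 𝕜 p σ τ)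
      (fun i : Fin (k + 1) => ((n : 𝕜) - (i : ℕ)) * p)
      (fun i : Fin (k + 1) =>
        k.choose i * (p - 1) ^ (k - (i : ℕ)) * (2 ^ p - p - 1) ^ (n - k)) ∧
    -- for each placement `c` of the non-free vertices: the `p ^ k`-dimensional `Ω(σ, τ; c)`
    (∀ c : Fin p → M.Simplex, DiscreteComplex.IsPlacement c (σ \ τ) →
      Module.finrank 𝕜 (DiscreteComplex.placedSubspace 𝕜 σ τ c) = p ^ k ∧
      DiscreteComplex.IsDiagonalizableOn (M.localLaplacian 𝕜 p)
        (DiscreteComplex.placedSubspace 𝕜 σ τ c)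
        (fun i : Fin (k + 1) => ((n : 𝕜) - (i : ℕ)) * p)
        (fun i : Fin (k + 1) => k.choose i * (p - 1) ^ (k - (i : ℕ))) ∧
      -- the eigenvectors `|n₁, …, n_k⟩`, for any enumeration `t` of the free vertices
      ∀ t : Fin k ↪ V, Finset.univ.map t = τ →
        (∀ m : Fin k → Fin p,
          M.localLaplacian 𝕜 p (DiscreteComplex.eigenvector 𝕜 c t m) =
            ((p : 𝕜) * ((n : 𝕜) - k + ∑ i, if (m i : ℕ) = 0 then 0 else 1)) •
              DiscreteComplex.eigenvector 𝕜 c t m) ∧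
        LinearIndependent 𝕜
          (fun m : Fin k → Fin p => DiscreteComplex.eigenvector 𝕜 c t m) ∧
        Submodule.span 𝕜
          (Set.range fun m : Fin k → Fin p => DiscreteComplex.eigenvector 𝕜 c t m) =
            DiscreteComplex.placedSubspace 𝕜 σ τ c) ∧
    -- `Δ_loc` is a derivation of the `⋆`-product of tuples without common vertices
    (∀ e f : Fin p → M.Simplex,
      Disjoint (DiscreteComplex.support e) (DiscreteComplex.support f) →
      DiscreteComplex.support e ∪ DiscreteComplex.support f ∈ M.faces →
      M.localLaplacian 𝕜 p
          (DiscreteComplex.star (Finsupp.single e (1 : 𝕜)) (Finsupp.single f 1)) =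
        DiscreteComplex.star (M.localLaplacian 𝕜 p (Finsupp.single e 1)) (Finsupp.single f 1) +
        DiscreteComplex.star (Finsupp.single e 1)
          (M.localLaplacian 𝕜 p (Finsupp.single f 1))) := by
  have hp0 : p ≠ 0 := by omega
  have hlam := eigenvalue_injective (𝕜 := 𝕜) (k := k) hp0 n
  have hcard : (σ \ τ).card = n - k := by rw [Finset.card_sdiff_of_subset hτ, hn, hk]
  have hplace : Nat.card {c : Fin p → M.Simplex // IsPlacement c (σ \ τ)} =
      (2 ^ p - p - 1) ^ (n - k) := by
    rw [card_placements (M.down_closed _ hσM _ Finset.sdiff_subset), hcard]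
  -- an arbitrary enumeration of the free vertices
  obtain ⟨s, hs, hsτ⟩ : ∃ s : Fin k → V, Function.Injective s ∧ Finset.univ.image s = τ :=
    ⟨τ.orderEmbOfFin hk.symm, (τ.orderEmbOfFin hk.symm).injective,
      Finset.image_orderEmbOfFin_univ _ _⟩
  have hfree := linearIndependent_vec_attach (𝕜 := 𝕜) (p := p) hσM hτ hs hsτ
  have hspan := span_attach_eq_freeSubspace (𝕜 := 𝕜) (p := p) hσM hσ hτ hs hsτ
  have hspan' := span_eigenvector_eq_freeSubspace (𝕜 := 𝕜) hp0 hσM hσ hτ hs hsτ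
  have hplacedLI : ∀ c : Fin p → M.Simplex, IsPlacement c (σ \ τ) →
      ∀ t : Fin k → V, Function.Injective t → Finset.univ.image t = τ →
      LinearIndependent 𝕜 (fun f : Fin k → Fin p => vec M 𝕜 (attach c t f)) :=
    fun c hc t ht htτ => (linearIndependent_vec_attach hσM hτ ht htτ).comp
      (fun f => (⟨c, hc⟩, f)) (Prod.mk_right_injective _)
  have hplacedEig : ∀ c : Fin p → M.Simplex, IsPlacement c (σ \ τ) →
      ∀ t : Fin k → V, Function.Injective t → Finset.univ.image t = τ →
      LinearIndependent 𝕜 (fun m : Fin k → Fin p => eigenvector 𝕜 c t m) :=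
    fun c hc t ht htτ => linearIndependent_of_span_eq (hplacedLI c hc t ht htτ) (by
      rw [span_eigenvector_eq_placedSubspace hp0 hσM hσ hτ hc ht htτ,
        placedSubspace_eq_span hσM hσ hτ hc ht htτ])
  refine ⟨fun u _ v _ => localLaplacian_selfAdjoint u v, ?_, ?_, fun c hc => ⟨?_, ?_, ?_⟩, ?_⟩
  · have := Fintype.ofFinite {c : Fin p → M.Simplex // IsPlacement c (σ \ τ)}
    rw [← hspan, finrank_span_eq_card hfree, Fintype.card_prod, ← Nat.card_eq_fintype_card, hplace]
    simp [mul_comm]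
  · have h := isDiagonalizableOn_of_eigenbasis hlam
      (linearIndependent_of_span_eq hfree (hspan'.trans hspan.symm)) hspan'
      (fun x => zeros x.2) (T := M.localLaplacian 𝕜 p) (fun x => by
        rw [localLaplacian_placed_eigenvector hσM hτ hk x.1.2 hs hsτ, eigenvalue_eq, hn])
    convert h using 2 with i
    rw [← card_zeros_fiber hp i, ← hplace, mul_comm, ← Nat.card_prod]
    exact Nat.card_congr
      { toFun := fun x => ⟨(x.1, x.2.1), x.2.2⟩
        invFun := fun x => (x.1.1, ⟨x.1.2, x.2⟩)
        left_inv := fun _ => rfl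
        right_inv := fun _ => rfl }
  · rw [placedSubspace_eq_span hσM hσ hτ hc hs hsτ,
      finrank_span_eq_card (hplacedLI c hc s hs hsτ)]
    simp
  · have h := isDiagonalizableOn_of_eigenbasis hlam (hplacedEig c hc s hs hsτ)
      (span_eigenvector_eq_placedSubspace hp0 hσM hσ hτ hc hs hsτ)
      zeros (T := M.localLaplacian 𝕜 p) (fun x => by
        rw [localLaplacian_placed_eigenvector hσM hτ hk hc hs hsτ, eigenvalue_eq, hn])
    convert h using 2 with i
    exact (card_zeros_fiber hp i).symm
  · intro t ht
    rw [Finset.map_eq_image] at ht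
    refine ⟨fun m => ?_, hplacedEig c hc t t.injective ht,
      span_eigenvector_eq_placedSubspace hp0 hσM hσ hτ hc t.injective ht⟩
    rw [hn]
    exact localLaplacian_placed_eigenvector hσM hτ hk hc t.injective ht m
  · intro e f hef hM
    simp only [← starHom_apply, ← vec_sites]
    rw [← vert_sites, ← vert_sites] at hef hM
    exact localLaplacian_starHom_vec hef hM
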